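/- **Proposition.** Let $(R,\mathfrak m,k)$ be a reduced Noetherian local ring of prime characteristic $p>0$ that is $F$-finite (the Frobenius endomorphism of $R$ is module-finite). Let $E$ be an injective hull of the residue field $k$, with the inclusion $k\hookrightarrow E$. For $q=p^e$ ($e\ge 0$) and an ideal $I$, let $I^{[q]}$ be the ideal generated by $\{a^q : a\in I\}$. Let $R^{(e)}$ be the $R$-bimodule with underlying group $R$ and $a\cdot r * b = a r b^{q}$; tensor products $R^{(e)}\otimes_R M$ use the right structure of $R^{(e)}$ and are regarded as $R$-modules by the left structure. Let $\lambda$ denote length over $R$. Then the following conditions are equivalent. * **Condition (A).** There are a decreasing sequence $I_1\supseteq I_2\supseteq\cdots$ of irreducible $\mathfrak m$-primary ideals of $R$, cofinal with the powers of $\mathfrak m$, elements $u_t\in R$ representing a nonzero socle element of $R/I_t$ (that is, $u_t\notin I_t$ and $\mathfrak m u_t\subseteq I_t$), and an index $t_0$ such that $$(I_t^{[q]} : u_t^{q}) = (I_{t_0}^{[q]} : u_{t_0}^{q})\qquad\text{for all } t\ge t_0 \text{ and all } q=p^e,\ e\ge 0.$$ * **Condition (B).** There is a submodule $E'$ of $E$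 of finite length, containing $k$, such that $\lambda(\ker\varphi_e)=\lambda(\ker\psi_e)$ for all $e\ge 0$, where $$\varphi_e : R^{(e)}\otimes_R E\to R^{(e)}\otimes_R (E/k),\qquad \psi_e : R^{(e)}\otimes_R E'\to R^{(e)}\otimes_R (E'/k)$$ are the maps induced by the projections $E\to E/k$ and $E'\to E'/k$. -/

import Mathlib

open IsLocalRing
open scoped TensorProduct

universe u

namespace FSignature

/-- A commutative ring of characteristic `p` is `F`-finite if its Frobenius endomorphism is
module-finite. -/
def FFinite (R : Type u) [CommRing R] (p : ℕ) [ExpChar R p] : Prop :=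
  (frobenius R p).Finite

section ConditionA

variable {R : Type u} [CommRing R]

/-- The Frobenius power `I^{[q]}`, `q = p ^ e`: the ideal generated by the elements `a ^ q` with
`a ∈ I` (that is, the extension of `I` along the `e`-th iterate `a ↦ a ^ q` of Frobenius). -/
def frobeniusPower (p : ℕ) [ExpChar R p] (I : Ideal R) (e : ℕ) : Ideal R :=
  I.map (iterateFrobenius R p e)

/-- The colon ideal `(I^{[q]} : u^q)` with `q = p ^ e`. -/
def frobeniusColon (p : ℕ) [ExpChar R p] (I : Ideal R) (u : R) (e : ℕ) : Ideal R :=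
  Submodule.colon (frobeniusPower p I e) {u ^ p ^ e}

/-- An irreducible `𝔪`-primary ideal (`InfIrred`: proper, and not the intersection of two strictly
larger ideals). -/
structure IsIrreducibleMPrimary [IsLocalRing R] (I : Ideal R) : Prop where
  irreducible : InfIrred I
  primary : I.IsPrimary
  radical_eq : I.radical = maximalIdeal R

/-- `u` represents a (nonzero) socle element of `R ⧸ I`. -/
structure RepresentsSocle [IsLocalRing R] (I : Ideal R) (u : R) : Prop where
  notMem : u ∉ I
  mul_mem : ∀ a ∈ maximalIdeal R, a * u ∈ I

/-- A decreasing sequence of irreducible `𝔪`-primary ideals that is cofinal with the powers of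
`𝔪` (each `I t` contains a power of `𝔪` if it is `𝔪`-primary and `R` is Noetherian). -/
structure IsGorensteinSequence [IsLocalRing R] (I : ℕ → Ideal R) : Prop where
  irreducible_primary : ∀ t, IsIrreducibleMPrimary (I t)
  antitone : Antitone I
  cofinal : ∀ n, ∃ t, I t ≤ maximalIdeal R ^ n

/-- Condition (A): for some decreasing sequence `I t` of irreducible `𝔪`-primary ideals cofinal
with the powers of `𝔪`, with socle representatives `u t`, the colon ideals
`(I_t^{[q]} : u_t^q)` are independent of `t ≥ t₀`, with `t₀` independent of `q = p ^ e`. -/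
def ConditionA (R : Type u) [CommRing R] [IsLocalRing R] (p : ℕ) [ExpChar R p] : Prop :=
  ∃ (I : ℕ → Ideal R) (u : ℕ → R), IsGorensteinSequence I ∧ (∀ t, RepresentsSocle (I t) (u t)) ∧
    ∃ t₀ : ℕ, ∀ t, t₀ ≤ t → ∀ e : ℕ,
      frobeniusColon p (I t) (u t) e = frobeniusColon p (I t₀) (u t₀) e

end ConditionA

section InjectiveHull

/-- `ι : M → E` is an injective hull of `M`: `ι` is injective, `E` is an injective module, and
`E` is an essential extension of the image of `M`. -/
structure IsInjectiveHull {R : Type u} [CommRing R] {M E : Type u} [AddCommGroup M] [Module R M]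
    [AddCommGroup E] [Module R E] (ι : M →ₗ[R] E) : Prop where
  injective : Function.Injective ι
  injective_module : Module.Injective R E
  essential : ∀ N : Submodule R E, N ⊓ LinearMap.range ι = ⊥ → N = ⊥

/-- Every module has an injective hull. -/
theorem exists_isInjectiveHull (R : Type u) [CommRing R] (M : Type u) [AddCommGroup M]
    [Module R M] : ∃ (E : Type u) (_ : AddCommGroup E) (_ : Module R E) (ι : M →ₗ[R] E),
      IsInjectiveHull ι := by
  obtain ⟨J, _, _, hJ, j, hj⟩ : ∃ (J : Type u) (_ : AddCommGroup J) (_ : Module R J),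
      Module.Injective R J ∧ ∃ j : M →ₗ[R] J, Function.Injective j := by
    obtain ⟨⟨J, hJ, f, hf⟩⟩ := (inferInstance : CategoryTheory.EnoughInjectives (ModuleCat.{u} R)).presentation
      (ModuleCat.of R M)
    refine ⟨J, inferInstance, inferInstance, ?_, f.hom, ?_⟩
    · exact (Module.injective_iff_injective_object R J).2 hJ
    · exact (ModuleCat.mono_iff_injective f).1 hf
  set K := LinearMap.range j with hK
  obtain ⟨N, hKN, hN⟩ := zorn_le_nonempty₀
    {N : Submodule R J | ∀ P ≤ N, P ⊓ K = ⊥ → P = ⊥} (by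
      intro c hc hch y hy
      refine ⟨sSup c, ?_, fun z hz => le_sSup hz⟩
      intro P hP hPK
      rw [eq_bot_iff]
      intro x hx
      obtain ⟨z, hz, hxz⟩ := (Submodule.mem_sSup_of_directed ⟨y, hy⟩ hch.directedOn).1 (hP hx)
      have := hc hz (P ⊓ z) inf_le_right (by
        rw [eq_bot_iff, ← hPK]; exact inf_le_inf_right _ inf_le_left)
      rw [← this]; exact ⟨hx, hxz⟩) K (by
      intro P hP h; rwa [inf_eq_left.2 hP] at h)
  obtain ⟨Q, -, hQ⟩ := zorn_le_nonempty₀ {Q : Submodule R J | Q ⊓ N = ⊥} (by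
      intro c hc hch y hy
      refine ⟨sSup c, ?_, fun z hz => le_sSup hz⟩
      rw [Set.mem_ofPred_eq, eq_bot_iff]
      rintro x ⟨hx, hxN⟩
      obtain ⟨z, hz, hxz⟩ := (Submodule.mem_sSup_of_directed ⟨y, hy⟩ hch.directedOn).1 hx
      have : z ⊓ N = ⊥ := hc hz
      rw [← this]; exact ⟨hxz, hxN⟩) ⊥ (by simp)
  have hQN : Q ⊓ N = ⊥ := hQ.prop
  obtain ⟨g, hg⟩ := hJ.out (Q.mkQ ∘ₗ N.subtype) (by
    rw [← LinearMap.ker_eq_bot, eq_bot_iff]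
    rintro ⟨x, hx⟩ h
    have hxQ : x ∈ Q := by simpa using h
    have : x ∈ Q ⊓ N := ⟨hxQ, hx⟩
    rw [hQN] at this
    simpa using this) N.subtype
  have hg' : ∀ x ∈ N, g (Q.mkQ x) = x := fun x hx => hg ⟨x, hx⟩
  have hrange : LinearMap.range (g ∘ₗ Q.mkQ) ≤ N := by
    refine hN.le_of_ge (y := LinearMap.range (g ∘ₗ Q.mkQ)) ?_ ?_
    · intro P hP hPK
      -- the preimage of `P` is no bigger than `Q`
      have hPN : P ⊓ N = ⊥ := hN.prop _ inf_le_right (by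
        rw [eq_bot_iff, ← hPK]; exact inf_le_inf_right _ inf_le_left)
      have hle : P.comap (g ∘ₗ Q.mkQ) ≤ Q := by
        have hmem : Q ⊔ P.comap (g ∘ₗ Q.mkQ) ∈ {Q : Submodule R J | Q ⊓ N = ⊥} := by
          rw [Set.mem_ofPred_eq, eq_bot_iff]
          rintro x ⟨hx, hxN⟩
          obtain ⟨a, ha, b, hb, rfl⟩ := Submodule.mem_sup.1 hx
          have h1 : g (Q.mkQ (a + b)) = a + b := hg' _ hxN
          have h2 : Q.mkQ a = 0 := by simpa using ha
          have h3 : g (Q.mkQ (a + b)) = g (Q.mkQ b) := by rw [map_add, h2, zero_add]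
          rw [← hPN]
          refine ⟨?_, hxN⟩
          rw [← h1, h3]; exact hb
        exact le_sup_right.trans (hQ.le_of_ge hmem le_sup_left)
      rw [eq_bot_iff]
      intro x hx
      obtain ⟨y, rfl⟩ := hP hx
      have hy : y ∈ Q := hle hx
      have h2 : Q.mkQ y = 0 := by simpa using hy
      simp only [LinearMap.comp_apply, h2, map_zero, Submodule.zero_mem]
    · intro x hx
      exact ⟨x, hg' x hx⟩
  let r : J →ₗ[R] N := (g ∘ₗ Q.mkQ).codRestrict N fun x => hrange ⟨x, rfl⟩
  have hr : ∀ x : N, r x = x := fun x => Subtype.ext (hg' x x.2)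
  refine ⟨N, inferInstance, inferInstance, j.codRestrict N fun x => hKN ⟨x, rfl⟩, ?_, ?_, ?_⟩
  · intro x y h
    exact hj (congrArg Subtype.val h)
  · refine ⟨fun X Y _ _ _ _ f hf a => ?_⟩
    obtain ⟨h, hh⟩ := hJ.out f hf (N.subtype ∘ₗ a)
    exact ⟨r ∘ₗ h, fun x => by
      rw [LinearMap.comp_apply, hh]; exact hr (a x)⟩
  · intro P hP
    have := hN.prop (P.map N.subtype) (Submodule.map_subtype_le N P) (by
      rw [eq_bot_iff]
      rintro _ ⟨⟨x, hx, rfl⟩, ⟨m, hm⟩⟩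
      have : x ∈ P ⊓ LinearMap.range (j.codRestrict N fun x => hKN ⟨x, rfl⟩) :=
        ⟨hx, m, Subtype.ext hm⟩
      rw [hP] at this
      simpa using this)
    exact Submodule.map_injective_of_injective N.injective_subtype (this.trans (Submodule.map_bot _).symm)

end InjectiveHull

section ConditionB

/-- The `R`-bimodule `R^{(e)}`: the underlying abelian group is `R`, the left multiplication is the
multiplication of `R` (here: the multiplication of the ring `FrobeniusTwist R p e`, which is the
ring `R`), and the right multiplication is `r * b = r b ^ (p ^ e)` (here: the `R`-algebra structure
given by the `e`-th iterate of Frobenius). -/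
def FrobeniusTwist (R : Type u) (_p _e : ℕ) : Type u := R

instance (R : Type u) [CommRing R] (p e : ℕ) : CommRing (FrobeniusTwist R p e) :=
  inferInstanceAs (CommRing R)

instance (R : Type u) [CommRing R] (p e : ℕ) [ExpChar R p] : Algebra R (FrobeniusTwist R p e) :=
  RingHom.toAlgebra (S := FrobeniusTwist R p e) (iterateFrobenius R p e)

/-- The map `R^{(e)} ⊗_R M → R^{(e)} ⊗_R (M / N)` induced by the projection `M → M / N`, linear for
the left multiplication on `R^{(e)}`. -/
noncomputable def frobeniusTensorQuot {R : Type u} [CommRing R] (p : ℕ) [ExpChar R p]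
    {M : Type u} [AddCommGroup M] [Module R M] (N : Submodule R M) (e : ℕ) :
    FrobeniusTwist R p e ⊗[R] M →ₗ[FrobeniusTwist R p e] FrobeniusTwist R p e ⊗[R] (M ⧸ N) :=
  N.mkQ.baseChange (FrobeniusTwist R p e)

/-- The length of the kernel of `R^{(e)} ⊗_R M → R^{(e)} ⊗_R (M / N)` as an `R`-module under left
multiplication. -/
noncomputable def kernelLength {R : Type u} [CommRing R] (p : ℕ) [ExpChar R p]
    {M : Type u} [AddCommGroup M] [Module R M] (N : Submodule R M) (e : ℕ) : ℕ∞ :=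
  Module.length (FrobeniusTwist R p e) (LinearMap.ker (frobeniusTensorQuot p N e))

/-- Condition (B), for an injective hull `ι : k → E` of the residue field: there is a submodule
`E'` of `E` of finite length, containing (the image of) `k`, such that for all `e` the kernels of
`φ_e : R^{(e)} ⊗ E → R^{(e)} ⊗ (E / k)` and `ψ_e : R^{(e)} ⊗ E' → R^{(e)} ⊗ (E' / k)` have the same
length. -/
def ConditionB {R : Type u} [CommRing R] [IsLocalRing R] (p : ℕ) [ExpChar R p]
    {E : Type u} [AddCommGroup E] [Module R E] (ι : ResidueField R →ₗ[R] E) : Prop :=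
  ∃ E' : Submodule R E, LinearMap.range ι ≤ E' ∧ IsFiniteLength R E' ∧
    ∀ e : ℕ, kernelLength p (LinearMap.range ι) e =
      kernelLength p ((LinearMap.range ι).submoduleOf E') e

end ConditionB

end FSignature

/-!
Let `E` be the injective hull of the residue field `k` and `w ∈ E` a generator of the socle `k`.
The kernel of `R^{(e)} ⊗ M → R^{(e)} ⊗ (M / R w)` is generated by `1 ⊗ w`, so its length is that of
`R / a_e(M)`, where `a_e(M)` is the annihilator of `1 ⊗ w` (`kernelLength_span_singleton`). These
lengths are finite and `a_e(E') ⊆ a_e(E)`, so condition (B) says that `a_e(E') = a_e(E)` for all `e`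
(`kernelLength_eq_iff`).

The irreducible `𝔪`-primary ideals `I` are the annihilators of the nonzero elements `x` of `E`, and
if `v` represents the socle of `R / I ≃ R x`, normalized by `v x = w`, then
`a_e(R x) = (I^{[q]} : v^q)` (`mem_tensorAnnihilator_iff_mem_frobeniusColon`). For a decreasing
sequence `I_t` cofinal with the powers of `𝔪`, every finitely generated submodule of `E` lies in
`R x_t` for large `t` (`exists_le_span_singleton`); this follows from the double annihilator
property, which needs only the bound `λ(Hom(M, E)) ≤ λ(M)`. As tensor products commute with
directed unions, `a_e(E)` is the union of the increasing sequence `(I_t^{[q]} : u_t^q)`. Hence (A)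
gives (B) with `E' = R x_{t₀}`, and conversely (B) gives (A) for *any* such sequence, once
`E' ⊆ R x_{t₀}`.

What remains is that such a sequence exists, i.e. that a reduced `F`-finite local ring `R` is
approximately Gorenstein (`exists_isSocleGenerator_le_pow`).

* The completion of `R` is again Noetherian, `F`-finite and reduced, and irreducible `𝔪`-primary
  ideals descend from it (`IsCompletionHom.isReduced`, `IsCompletionHom.ffinite`,
  `IsSocleGenerator.comap_of_isCompletionHom`). Reducedness passes to the completion by the
  Artin-Rees lemma for `R ⊆ R^{(1)}`.
* Let `B` be a complete `F`-finite local domain. A suitable multiple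
  `π : B^{(1)} → B`, `π(r^p x) = r π(x)`, of a generator of the dual over the fraction field
  has a test element `c ≠ 0`, lying in every ideal that contains all `π^b(d B)` for some `d ≠ 0`
  (`exists_testElement`). Let `J` be an irreducible `𝔪`-primary ideal
  with `c ^ 2 ∉ J`. The largest ideals `I_e` with `π^e(I_e) ⊆ J` are irreducible, since the dual of
  `k^{(1)}` is one-dimensional (`IsSocleGenerator.cartierPullback`). As `c` is a value of every
  iterate of `π`, it satisfies `c I_{e+1} ⊆ I_e`. If `c d` is in all `I_e`, then `d = 0`, as
  otherwise `c ∈ J`; by Chevalley's theorem for the ideals `{d | c d ∈ I_i for all i ≤ e}`, some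
  `I_e` lies in a given power of the maximal ideal (`exists_isSocleGenerator_of_isPrime`).
* If `R` is complete and reduced with minimal primes `P`, then elements `x_P` of `E` whose
  annihilators contain `P` and lie in `P + 𝔪 ^ N`, with `N` large, have a sum whose annihilator
  lies in a given power of `𝔪`, again by Chevalley's theorem
  (`exists_isSocleGenerator_le_pow_of_isAdicComplete`).
-/

namespace FSignature

/-! ### Irreducible primary ideals and their socles -/

section Irreducible

variable {R : Type u} [CommRing R] [IsLocalRing R]

/-- `I` contains a power of the maximal ideal, and `u` represents an element of `R ⧸ I` which is
nonzero and lies in every nonzero ideal of `R ⧸ I`. -/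
structure IsSocleGenerator (I : Ideal R) (u : R) : Prop where
  exists_pow_le : ∃ k, maximalIdeal R ^ k ≤ I
  notMem : u ∉ I
  exists_mul_sub_mem : ∀ s ∉ I, ∃ r, r * s - u ∈ I

variable {I : Ideal R} {u : R}

lemma IsSocleGenerator.ne_top (h : IsSocleGenerator I u) : I ≠ ⊤ :=
  fun hI => h.notMem (hI ▸ Submodule.mem_top)

lemma IsSocleGenerator.mul_mem (h : IsSocleGenerator I u) {a : R} (ha : a ∈ maximalIdeal R) :
    a * u ∈ I := by
  by_contra hau
  obtain ⟨r, hr⟩ := h.exists_mul_sub_mem _ hau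
  have hu : IsUnit (1 - r * a) :=
    (IsLocalRing.isUnit_or_isUnit_one_sub_self (r * a)).resolve_left
      ((mem_maximalIdeal _).1 (Ideal.mul_mem_left _ r ha))
  apply h.notMem
  rw [← Ideal.unit_mul_mem_iff_mem I hu]
  have := I.neg_mem hr
  convert this using 1; ring

lemma IsSocleGenerator.representsSocle (h : IsSocleGenerator I u) : RepresentsSocle I u :=
  ⟨h.notMem, fun _ ha => h.mul_mem ha⟩

lemma IsSocleGenerator.isIrreducibleMPrimary (h : IsSocleGenerator I u) :
    IsIrreducibleMPrimary I := by
  have hrad : I.radical = maximalIdeal R := by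
    apply le_antisymm
    · exact le_maximalIdeal fun hI => h.ne_top (Ideal.radical_eq_top.1 hI)
    · obtain ⟨k, hk⟩ := h.exists_pow_le
      exact fun x hx => ⟨k, hk (Ideal.pow_mem_pow hx k)⟩
  refine ⟨⟨fun hI => h.ne_top hI.eq_top, ?_⟩, Ideal.isPrimary_of_isMaximal_radical
    (hrad ▸ inferInstance), hrad⟩
  intro b c hbc
  -- every ideal strictly larger than `I` contains `u`
  have key : ∀ d : Ideal R, I ≤ d → d ≠ I → u ∈ d := by
    intro d hd hne
    obtain ⟨s, hsd, hsI⟩ := SetLike.exists_of_lt (lt_of_le_of_ne hd hne.symm)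
    obtain ⟨r, hr⟩ := h.exists_mul_sub_mem s hsI
    simpa using d.sub_mem (d.mul_mem_left r hsd) (hd hr)
  by_contra! hne
  refine h.notMem (hbc ▸ ⟨key b (hbc ▸ inf_le_left) hne.1, key c (hbc ▸ inf_le_right) hne.2⟩)

lemma exists_mul_representsSocle {k : ℕ} (hk : maximalIdeal R ^ k ≤ I) {s : R} (hs : s ∉ I) :
    ∃ a, RepresentsSocle I (a * s) := by
  classical
  have hex : ∃ j, ∀ a ∈ maximalIdeal R ^ j, a * s ∈ I :=
    ⟨k, fun a ha => I.mul_mem_right s (hk ha)⟩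
  obtain ⟨j, hj⟩ : ∃ j, Nat.find hex = j + 1 := by
    refine Nat.exists_eq_succ_of_ne_zero fun h0 => hs ?_
    have := Nat.find_spec hex
    rw [h0] at this
    simpa using this 1 (by simp)
  have hmin := Nat.find_min hex (m := j) (by omega)
  push Not at hmin
  obtain ⟨a, ha, has⟩ := hmin
  refine ⟨a, has, fun b hb => ?_⟩
  rw [← mul_assoc]
  refine Nat.find_spec hex _ ?_
  rw [hj, pow_succ']
  exact Ideal.mul_mem_mul hb ha

/-- An ideal containing a power of the maximal ideal whose residue ring has a one-dimensional
socle admits a socle generator. -/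
lemma exists_isSocleGenerator (hI : I ≠ ⊤) (hk : ∃ k, maximalIdeal R ^ k ≤ I)
    (h : ∀ s s', RepresentsSocle I s → RepresentsSocle I s' → ∃ r, r * s - s' ∈ I) :
    ∃ u, IsSocleGenerator I u := by
  obtain ⟨k, hk⟩ := hk
  obtain ⟨a, ha⟩ := exists_mul_representsSocle hk ((Ideal.ne_top_iff_one I).1 hI)
  refine ⟨a * 1, ⟨k, hk⟩, ha.notMem, fun s hs => ?_⟩
  obtain ⟨b, hb⟩ := exists_mul_representsSocle hk hs
  obtain ⟨r, hr⟩ := h _ _ hb ha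
  exact ⟨r * b, by rwa [mul_assoc]⟩

lemma IsIrreducibleMPrimary.isSocleGenerator [IsNoetherianRing R] (h : IsIrreducibleMPrimary I)
    (hu : RepresentsSocle I u) : IsSocleGenerator I u := by
  refine ⟨?_, hu.notMem, fun s hs => ?_⟩
  · obtain ⟨k, hk⟩ := I.exists_radical_pow_le_of_fg (IsNoetherian.noetherian _)
    exact ⟨k, h.radical_eq ▸ hk⟩
  · have hne : (I ⊔ Ideal.span {s}) ⊓ (I ⊔ Ideal.span {u}) ≠ I := by
      intro heq
      rcases h.irreducible.2 heq with h1 | h1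
      · exact hs (h1 ▸ Ideal.mem_sup_right (Ideal.mem_span_singleton_self s))
      · exact hu.notMem (h1 ▸ Ideal.mem_sup_right (Ideal.mem_span_singleton_self u))
    obtain ⟨w, ⟨hws, hwu⟩, hwI⟩ := SetLike.exists_of_lt
      (lt_of_le_of_ne (le_inf le_sup_left le_sup_left) hne.symm)
    obtain ⟨i, hi, y, hy, rfl⟩ := Submodule.mem_sup.1 hwu
    obtain ⟨a, rfl⟩ := Ideal.mem_span_singleton'.1 hy
    obtain ⟨i', hi', y', hy', hw⟩ := Submodule.mem_sup.1 hws
    obtain ⟨b, rfl⟩ := Ideal.mem_span_singleton'.1 hy'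
    have ha : IsUnit a := by
      by_contra ha
      exact hwI (I.add_mem hi (hu.mul_mem a ((mem_maximalIdeal a).2 ha)))
    obtain ⟨c, hc⟩ := ha.exists_left_inv
    refine ⟨c * b, ?_⟩
    have : c * b * s - u = c * (i - i') := by
      linear_combination c * hw + u * hc
    rw [this]
    exact I.mul_mem_left _ (I.sub_mem hi hi')

end Irreducible

/-! ### Finite length -/

section Length

/-- A submodule contained in another one of no larger, finite length is equal to it. -/
lemma eq_of_le_of_length_le {R M : Type*} [Ring R] [AddCommGroup M] [Module R M]
    {N N' : Submodule R M} (h : N ≤ N') (hl : Module.length R N' ≤ Module.length R N)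
    (hfin : Module.length R N ≠ ⊤) : N = N' := by
  have hN' : IsFiniteLength R N' := Module.length_ne_top_iff.1 (ne_top_of_le_ne_top hfin hl)
  obtain ⟨_, _⟩ := isFiniteLength_iff_isNoetherian_isArtinian.1 hN'
  by_contra hne
  have hlt := Submodule.length_lt (N := N.submoduleOf N') (by
    rw [ne_eq, Submodule.submoduleOf_eq_top]
    exact fun h' => hne (le_antisymm h h'))
  rw [(Submodule.submoduleOfEquivOfLe h).length_eq] at hlt
  exact absurd hl (not_le.2 hlt)

lemma isFiniteLength_quotient_of_pow_le {R : Type*} [CommRing R] [IsLocalRing R]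
    [IsNoetherianRing R] {I : Ideal R} {k : ℕ} (hk : maximalIdeal R ^ k ≤ I) :
    IsFiniteLength R (R ⧸ I) := by
  rw [isFiniteLength_iff_isNoetherian_isArtinian]
  refine ⟨inferInstance, ?_⟩
  by_cases hI : I = ⊤
  · subst hI
    have : Subsingleton (R ⧸ (⊤ : Ideal R)) := Ideal.Quotient.subsingleton_iff.2 rfl
    infer_instance
  have : Nontrivial (R ⧸ I) := Ideal.Quotient.nontrivial_iff.2 hI
  have : IsLocalRing (R ⧸ I) := .of_surjective' (Ideal.Quotient.mk I) Ideal.Quotient.mk_surjective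
  have : IsArtinianRing (R ⧸ I) := by
    rw [isArtinianRing_iff_isNilpotent_maximalIdeal]
    refine ⟨k, ?_⟩
    have := IsLocalHom.of_surjective (Ideal.Quotient.mk I) Ideal.Quotient.mk_surjective
    have hmap : (maximalIdeal R).map (Ideal.Quotient.mk I) = maximalIdeal (R ⧸ I) := by
      ext x
      obtain ⟨x, rfl⟩ := Ideal.Quotient.mk_surjective x
      simp [sup_eq_left.mpr (le_maximalIdeal hI)]
    rw [← hmap, ← Ideal.map_pow, Ideal.zero_eq_bot, Ideal.map_eq_bot_iff_le_ker, Ideal.mk_ker]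
    exact hk
  exact isArtinian_of_surjective_algebraMap (S := R) (R := R ⧸ I) Ideal.Quotient.mk_surjective

end Length

/-! ### The injective hull of the residue field -/

section InjectiveHull

variable {R : Type u} [CommRing R] [IsLocalRing R] {E : Type u} [AddCommGroup E] [Module R E]
  {ι : ResidueField R →ₗ[R] E}

lemma smul_map_one_eq_zero_iff (hι : Function.Injective ι) {a : R} :
    a • ι 1 = 0 ↔ a ∈ maximalIdeal R := by
  rw [← map_smul, map_eq_zero_iff ι hι, Algebra.smul_def, mul_one, ResidueField.algebraMap_eq,
    residue_eq_zero_iff]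

lemma range_eq_span_map_one (ι : ResidueField R →ₗ[R] E) :
    LinearMap.range ι = Submodule.span R {ι 1} := by
  ext x
  rw [Submodule.mem_span_singleton]
  constructor
  · rintro ⟨t, rfl⟩
    obtain ⟨a, rfl⟩ := residue_surjective t
    exact ⟨a, by rw [← map_smul, Algebra.smul_def, mul_one]; rfl⟩
  · rintro ⟨a, rfl⟩
    exact ⟨a • 1, map_smul ..⟩

lemma IsInjectiveHull.map_one_ne_zero (hι : IsInjectiveHull ι) : ι 1 ≠ 0 := by
  rw [ne_eq, map_eq_zero_iff ι hι.injective]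
  exact one_ne_zero

lemma IsInjectiveHull.exists_smul_eq_map_one (hι : IsInjectiveHull ι) {x : E} (hx : x ≠ 0) :
    ∃ r : R, r • x = ι 1 := by
  have hne : Submodule.span R {x} ⊓ LinearMap.range ι ≠ ⊥ := fun h =>
    hx (Submodule.span_singleton_eq_bot.1 (hι.essential _ h))
  obtain ⟨y, ⟨hyx, hyι⟩, hy⟩ := Submodule.exists_mem_ne_zero_of_ne_bot hne
  obtain ⟨a, rfl⟩ := Submodule.mem_span_singleton.1 hyx
  rw [range_eq_span_map_one] at hyι
  obtain ⟨b, hb⟩ := Submodule.mem_span_singleton.1 hyι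
  have hbu : IsUnit b := by
    by_contra hb'
    exact hy (hb ▸ (smul_map_one_eq_zero_iff hι.injective).2 ((mem_maximalIdeal b).2 hb'))
  obtain ⟨c, hc⟩ := hbu.exists_left_inv
  exact ⟨c * a, by rw [mul_smul, ← hb, smul_smul, hc, one_smul]⟩

/-- Every element of the injective hull of the residue field is killed by a power of the maximal
ideal: otherwise `ι 1` would lie in all `𝔪 ^ n • Rx`, contradicting Krull's intersection
theorem. -/
lemma IsInjectiveHull.exists_pow_smul_eq_zero [IsNoetherianRing R] (hι : IsInjectiveHull ι)
    (x : E) : ∃ n, ∀ a ∈ maximalIdeal R ^ n, a • x = 0 := by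
  by_contra! h
  obtain ⟨a, -, hax⟩ := h 0
  have hx : x ≠ 0 := fun h0 => hax (by rw [h0, smul_zero])
  obtain ⟨r, hr⟩ := hι.exists_smul_eq_map_one hx
  let y : Submodule.span R {x} := ⟨ι 1, Submodule.mem_span_singleton.2 ⟨r, hr⟩⟩
  have hy : y ∈ (⨅ n : ℕ, maximalIdeal R ^ n • ⊤ : Submodule R (Submodule.span R {x})) := by
    rw [Submodule.mem_iInf]
    intro n
    obtain ⟨a, ha, hax⟩ := h n
    obtain ⟨s, hs⟩ := hι.exists_smul_eq_map_one hax
    have : y = (s * a) • (⟨x, Submodule.mem_span_singleton_self x⟩ : Submodule.span R {x}) :=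
      Subtype.ext (by simp [y, mul_smul, hs])
    rw [this]
    exact Submodule.smul_mem_smul (Ideal.mul_mem_left _ s ha) trivial
  rw [Ideal.iInf_pow_smul_eq_bot_of_isLocalRing _ (Ideal.IsPrime.ne_top inferInstance)] at hy
  exact hι.map_one_ne_zero (congrArg Subtype.val ((Submodule.mem_bot R).1 hy))

/-- The annihilator of a nonzero element `x` of the injective hull of the residue field has simple
socle, since `R ⧸ ann x ≃ R x ⊆ E`. -/
lemma IsInjectiveHull.isSocleGenerator_torsionOf [IsNoetherianRing R] (hι : IsInjectiveHull ι)
    {x : E} {v : R} (hv : v • x = ι 1) : IsSocleGenerator (Ideal.torsionOf R E x) v := by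
  refine ⟨?_, ?_, ?_⟩
  · obtain ⟨n, hn⟩ := hι.exists_pow_smul_eq_zero x
    exact ⟨n, fun a ha => (Ideal.mem_torsionOf_iff x a).2 (hn a ha)⟩
  · rw [Ideal.mem_torsionOf_iff, hv]
    exact hι.map_one_ne_zero
  · intro s hs
    obtain ⟨r, hr⟩ := hι.exists_smul_eq_map_one (mt (Ideal.mem_torsionOf_iff x s).2 hs)
    exact ⟨r, by rw [Ideal.mem_torsionOf_iff, sub_smul, mul_smul, hr, hv, sub_self]⟩

/-- An ideal with simple socle is the annihilator of an element of the injective hull `E` of the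
residue field: extend the inclusion of the socle of `R ⧸ I` into `E` to `R ⧸ I`. -/
lemma IsSocleGenerator.exists_torsionOf_eq (hι : IsInjectiveHull ι) {I : Ideal R} {u : R}
    (h : IsSocleGenerator I u) : ∃ x : E, Ideal.torsionOf R E x = I ∧ u • x = ι 1 := by
  have hker : maximalIdeal R ≤ LinearMap.ker (LinearMap.toSpanSingleton R (R ⧸ I)
      (Ideal.Quotient.mk I u)) := by
    intro a ha
    rw [LinearMap.mem_ker, LinearMap.toSpanSingleton_apply, Algebra.smul_def]
    exact Ideal.Quotient.eq_zero_iff_mem.2 (h.mul_mem ha)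
  let j : ResidueField R →ₗ[R] R ⧸ I := Submodule.liftQ (maximalIdeal R) _ hker
  have hj1 : j 1 = Ideal.Quotient.mk I u := by
    change (LinearMap.toSpanSingleton R (R ⧸ I) (Ideal.Quotient.mk I u)) 1 = _
    rw [LinearMap.toSpanSingleton_apply, one_smul]
  have hj : Function.Injective j := by
    rw [injective_iff_map_eq_zero]
    intro t ht
    obtain ⟨a, rfl⟩ := residue_surjective t
    rw [residue_eq_zero_iff, mem_maximalIdeal]
    intro ha
    refine h.notMem ((Ideal.unit_mul_mem_iff_mem I ha).1 (Ideal.Quotient.eq_zero_iff_mem.1 ?_))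
    have : residue R a = a • (1 : ResidueField R) := by rw [Algebra.smul_def, mul_one]; rfl
    rw [this, map_smul, hj1] at ht
    exact ht
  obtain ⟨f, hf⟩ := hι.injective_module.out j hj ι
  refine ⟨f 1, ?_, ?_⟩
  · have key : ∀ r : R, r • f 1 = f (Ideal.Quotient.mk I r) := fun r => by
      rw [← map_smul, Algebra.smul_def, mul_one]; rfl
    ext s
    rw [Ideal.mem_torsionOf_iff, key]
    constructor
    · intro hs
      by_contra hsI
      obtain ⟨r, hr⟩ := h.exists_mul_sub_mem s hsI
      apply hι.map_one_ne_zero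
      rw [← hf, hj1, ← Ideal.Quotient.eq.2 hr, map_mul]
      change f (r • Ideal.Quotient.mk I s) = 0
      rw [map_smul, hs, smul_zero]
    · intro hs
      rw [Ideal.Quotient.eq_zero_iff_mem.2 hs, map_zero]
  · rw [← hf, hj1, ← map_smul, Algebra.smul_def, mul_one]; rfl

lemma IsInjectiveHull.mem_range_of_maximalIdeal_smul (hι : IsInjectiveHull ι) {y : E}
    (hy : ∀ a ∈ maximalIdeal R, a • y = 0) : y ∈ LinearMap.range ι := by
  by_cases h0 : y = 0
  · exact h0 ▸ Submodule.zero_mem _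
  obtain ⟨r, hr⟩ := hι.exists_smul_eq_map_one h0
  have hru : IsUnit r := by
    by_contra hr'
    exact hι.map_one_ne_zero (hr ▸ hy r ((mem_maximalIdeal r).2 hr'))
  obtain ⟨c, hc⟩ := hru.exists_left_inv
  exact ⟨c • 1, by rw [map_smul, ← hr, smul_smul, hc, one_smul]⟩

lemma IsInjectiveHull.length_hom_le_one (hι : IsInjectiveHull ι) {V : Type u} [AddCommGroup V]
    [Module R V] [IsSimpleModule R V] : Module.length R (V →ₗ[R] E) ≤ 1 := by
  have := IsSimpleModule.nontrivial R V
  obtain ⟨v, hv⟩ := exists_ne (0 : V)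
  have hmv : ∀ a ∈ maximalIdeal R, a • v = 0 := by
    have := eq_maximalIdeal (IsSimpleModule.annihilator_isMaximal (R := R) (M := V))
    intro a ha
    rw [← this] at ha
    exact Module.mem_annihilator.1 ha v
  let ev : (V →ₗ[R] E) →ₗ[R] LinearMap.range ι :=
    (LinearMap.applyₗ v).codRestrict _ fun f => hι.mem_range_of_maximalIdeal_smul fun a ha => by
      rw [LinearMap.applyₗ_apply_apply, ← map_smul, hmv a ha, map_zero]
  have hev : Function.Injective ev := by
    rw [injective_iff_map_eq_zero]
    intro f hf
    have hfv : f v = 0 := congrArg Subtype.val hf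
    ext w
    have hw : w ∈ Submodule.span R {v} := by
      rw [IsSimpleModule.span_singleton_eq_top R hv]; trivial
    obtain ⟨r, rfl⟩ := Submodule.mem_span_singleton.1 hw
    rw [map_smul, hfv, smul_zero, LinearMap.zero_apply]
  have : IsSimpleModule R (ResidueField R) :=
    isSimpleModule_iff_quot_maximal.2 ⟨maximalIdeal R, inferInstance, ⟨LinearEquiv.refl R _⟩⟩
  calc Module.length R (V →ₗ[R] E) ≤ Module.length R (LinearMap.range ι) :=
        Module.length_le_of_injective ev hev
    _ ≤ Module.length R (ResidueField R) :=
        Module.length_le_of_surjective ι.rangeRestrict ι.surjective_rangeRestrict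
    _ = 1 := Module.length_eq_one ..

/-- One half of Matlis duality: `λ(Hom(M, E)) ≤ λ(M)`. -/
lemma IsInjectiveHull.length_hom_le (hι : IsInjectiveHull ι) {M : Type u} [AddCommGroup M]
    [Module R M] (hM : IsFiniteLength R M) :
    Module.length R (M →ₗ[R] E) ≤ Module.length R M := by
  induction hM with
  | of_subsingleton =>
    rw [Module.length_eq_zero]
    exact zero_le
  | @of_simple_quotient M _ _ N _ _ ih =>
    let res : (M →ₗ[R] E) →ₗ[R] (N →ₗ[R] E) := LinearMap.lcomp R E N.subtype
    let q : (M ⧸ N →ₗ[R] E) →ₗ[R] (M →ₗ[R] E) := LinearMap.lcomp R E N.mkQ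
    have hex : Function.Exact q res.rangeRestrict := by
      intro f
      constructor
      · intro hf
        have hf' : N ≤ LinearMap.ker f := fun x hx =>
          LinearMap.congr_fun (congrArg Subtype.val hf) ⟨x, hx⟩
        exact ⟨N.liftQ f hf', LinearMap.ext fun x => by simp [q]⟩
      · rintro ⟨g, rfl⟩
        refine Subtype.ext (LinearMap.ext fun x => ?_)
        change g (N.mkQ x) = 0
        rw [Submodule.mkQ_apply, (Submodule.Quotient.mk_eq_zero N).2 x.2, map_zero]
    have hq : Function.Injective q := fun f g hfg => by
      refine LinearMap.ext fun x => ?_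
      obtain ⟨x, rfl⟩ := N.mkQ_surjective x
      exact LinearMap.congr_fun hfg x
    rw [Module.length_eq_add_of_exact q res.rangeRestrict hq res.surjective_rangeRestrict hex,
      Module.length_eq_add_of_exact N.subtype N.mkQ N.subtype_injective N.mkQ_surjective
        (LinearMap.exact_subtype_mkQ N), add_comm, Module.length_eq_one R (M ⧸ N)]
    exact add_le_add ((Module.length_le_of_injective _ (Submodule.subtype_injective _)).trans ih)
      hι.length_hom_le_one

/-- The double annihilator property: an element of `E` killed by the annihilator of `x` is a
multiple of `x`. -/
lemma IsInjectiveHull.mem_span_of_torsionOf_le [IsNoetherianRing R] (hι : IsInjectiveHull ι)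
    {x y : E} (h : Ideal.torsionOf R E x ≤ Ideal.torsionOf R E y) :
    y ∈ Submodule.span R {x} := by
  set I := Ideal.torsionOf R E x with hI
  obtain ⟨n, hn⟩ := hι.exists_pow_smul_eq_zero x
  have hfin : IsFiniteLength R (R ⧸ I) := isFiniteLength_quotient_of_pow_le
    (fun a ha => (Ideal.mem_torsionOf_iff x a).2 (hn a ha))
  let ev : (R ⧸ I →ₗ[R] E) →ₗ[R] E := LinearMap.applyₗ (1 : R ⧸ I)
  have hmem : ∀ z, I ≤ Ideal.torsionOf R E z → z ∈ LinearMap.range ev := fun z hz =>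
    ⟨Submodule.liftQ I (LinearMap.toSpanSingleton R E z) hz, by
      change LinearMap.toSpanSingleton R E z 1 = z
      simp⟩
  have hlen : Module.length R (Submodule.span R {x}) = Module.length R (R ⧸ I) :=
    (Ideal.quotTorsionOfEquivSpanSingleton R E x).length_eq.symm
  have heq : Submodule.span R {x} = LinearMap.range ev := by
    refine eq_of_le_of_length_le ?_ ?_ ?_
    · rw [Submodule.span_singleton_le_iff_mem]
      exact hmem x le_rfl
    · rw [hlen]
      exact (Module.length_le_of_surjective ev.rangeRestrict ev.surjective_rangeRestrict).trans
        (hι.length_hom_le hfin)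
    · rw [hlen]
      exact Module.length_ne_top_iff.2 hfin
  rw [heq]
  exact hmem y h

end InjectiveHull

/-! ### Annihilators in tensor products -/

section BaseChange

variable (R : Type*) [CommRing R] (A : Type*) [CommRing A] [Algebra R A]
  {M : Type*} [AddCommGroup M] [Module R M] {M' : Type*} [AddCommGroup M'] [Module R M']

/-- The annihilator of `1 ⊗ u` in the `A`-module `A ⊗ M`. -/
noncomputable def tensorAnnihilator (u : M) : Ideal A :=
  Ideal.torsionOf A (A ⊗[R] M) (1 ⊗ₜ u)

variable {R A}

lemma mem_tensorAnnihilator {u : M} {s : A} :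
    s ∈ tensorAnnihilator R A u ↔ s ⊗ₜ[R] u = 0 := by
  rw [tensorAnnihilator, Ideal.mem_torsionOf_iff, TensorProduct.smul_tmul', smul_eq_mul, mul_one]

lemma tensorAnnihilator_le_of_map (f : M →ₗ[R] M') (u : M) :
    tensorAnnihilator R A u ≤ tensorAnnihilator R A (f u) := by
  intro s hs
  rw [mem_tensorAnnihilator] at hs ⊢
  rw [← LinearMap.lTensor_tmul, hs, map_zero]

lemma tensorAnnihilator_mono {N N' : Submodule R M} (h : N ≤ N') {u : M} (hu : u ∈ N) :
    tensorAnnihilator R A (⟨u, hu⟩ : N) ≤ tensorAnnihilator R A (⟨u, h hu⟩ : N') :=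
  tensorAnnihilator_le_of_map (Submodule.inclusion h) _

lemma tensorAnnihilator_map_equiv (f : M ≃ₗ[R] M') (u : M) :
    tensorAnnihilator R A (f u) = tensorAnnihilator R A u := by
  apply le_antisymm
  · simpa using tensorAnnihilator_le_of_map (A := A) f.symm.toLinearMap (f u)
  · exact tensorAnnihilator_le_of_map f.toLinearMap u

lemma mem_tensorAnnihilator_quotient_mk {I : Ideal R} {v : R} {s : A} :
    s ∈ tensorAnnihilator R A (Ideal.Quotient.mk I v) ↔
      algebraMap R A v * s ∈ I.map (algebraMap R A) := by
  rw [mem_tensorAnnihilator, ← (TensorProduct.comm R A (R ⧸ I)).map_eq_zero_iff,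
    TensorProduct.comm_tmul, ← (TensorProduct.quotTensorEquivQuotSMul A I).map_eq_zero_iff,
    TensorProduct.quotTensorEquivQuotSMul_mk_tmul, Submodule.Quotient.mk_eq_zero,
    Ideal.smul_top_eq_map, Algebra.smul_def]
  rfl

lemma mem_tensorAnnihilator_span_singleton {x u : M} {v : R} (hv : v • x = u)
    (hu : u ∈ Submodule.span R {x}) {s : A} :
    s ∈ tensorAnnihilator R A (⟨u, hu⟩ : Submodule.span R {x}) ↔
      algebraMap R A v * s ∈ (Ideal.torsionOf R M x).map (algebraMap R A) := by
  rw [← mem_tensorAnnihilator_quotient_mk,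
    ← tensorAnnihilator_map_equiv (Ideal.quotTorsionOfEquivSpanSingleton R M x)]
  have : Ideal.quotTorsionOfEquivSpanSingleton R M x (Ideal.Quotient.mk _ v) = ⟨u, hu⟩ :=
    Subtype.ext hv
  rw [this]

/-- Tensor products commute with the union of the finitely generated submodules. -/
lemma exists_fg_mem_tensorAnnihilator {u : M} {s : A} (hs : s ∈ tensorAnnihilator R A u) :
    ∃ (N : Submodule R M) (hu : u ∈ N), N.FG ∧ s ∈ tensorAnnihilator R A (⟨u, hu⟩ : N) := by
  rw [mem_tensorAnnihilator, ← (TensorProduct.comm R A M).map_eq_zero_iff,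
    TensorProduct.comm_tmul] at hs
  let P := Submodule.span R {u}
  have hP : P.FG := Submodule.fg_span_singleton u
  obtain ⟨N, hPN, hN, h⟩ := TensorProduct.eq_zero_of_fg_of_subtype_eq_zero (N := A) hP
    (t := (⟨u, Submodule.mem_span_singleton_self u⟩ : P) ⊗ₜ[R] s) hs
  refine ⟨N, hPN (Submodule.mem_span_singleton_self u), hN, ?_⟩
  rw [mem_tensorAnnihilator, ← (TensorProduct.comm R A N).map_eq_zero_iff]
  exact h

lemma ker_baseChange_mkQ_span_singleton (u : M) :
    LinearMap.ker ((Submodule.span R {u}).mkQ.baseChange A) =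
      Submodule.span A {(1 : A) ⊗ₜ[R] u} := by
  have hex := lTensor_exact A (LinearMap.exact_subtype_mkQ (Submodule.span R {u}))
    (Submodule.mkQ_surjective _)
  apply le_antisymm
  · intro z hz
    obtain ⟨w, rfl⟩ := (hex z).1 hz
    induction w with
    | zero => rw [map_zero]; exact Submodule.zero_mem _
    | add x y hx hy =>
      rw [map_add]
      refine Submodule.add_mem _ (hx ?_) (hy ?_)
      all_goals exact (hex _).2 ⟨_, rfl⟩
    | tmul a y =>
      obtain ⟨y, hy⟩ := y
      obtain ⟨r, rfl⟩ := Submodule.mem_span_singleton.1 hy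
      refine Submodule.mem_span_singleton.2 ⟨r • a, ?_⟩
      simp [TensorProduct.smul_tmul']
  · rw [Submodule.span_singleton_le_iff_mem, LinearMap.mem_ker, LinearMap.baseChange_tmul,
      Submodule.mkQ_apply, (Submodule.Quotient.mk_eq_zero _).2
        (Submodule.mem_span_singleton_self u),
      TensorProduct.tmul_zero]

end BaseChange

/-! ### Frobenius colon ideals and kernels -/

section KernelLength

variable {R : Type u} [CommRing R] (p : ℕ) [ExpChar R p]
  {M : Type u} [AddCommGroup M] [Module R M]

lemma kernelLength_span_singleton (u : M) (e : ℕ) :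
    kernelLength p (Submodule.span R {u}) e = Module.length (FrobeniusTwist R p e)
      (FrobeniusTwist R p e ⧸ tensorAnnihilator R (FrobeniusTwist R p e) u) := by
  rw [kernelLength, frobeniusTensorQuot, ker_baseChange_mkQ_span_singleton]
  exact (Ideal.quotTorsionOfEquivSpanSingleton ..).length_eq.symm

lemma algebraMap_frobeniusTwist (e : ℕ) (a : R) :
    algebraMap R (FrobeniusTwist R p e) a = (show FrobeniusTwist R p e from a ^ p ^ e) :=
  iterateFrobenius_def p e a

lemma isFiniteLength_quotient_tensorAnnihilator [IsLocalRing R] [IsNoetherianRing R] {u : M}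
    (hu : ∀ a ∈ maximalIdeal R, a • u = 0) (e : ℕ) :
    IsFiniteLength (FrobeniusTwist R p e)
      (FrobeniusTwist R p e ⧸ tensorAnnihilator R (FrobeniusTwist R p e) u) := by
  have : IsLocalRing (FrobeniusTwist R p e) := inferInstanceAs (IsLocalRing R)
  have : IsNoetherianRing (FrobeniusTwist R p e) := inferInstanceAs (IsNoetherianRing R)
  have key : ∀ a ∈ maximalIdeal R, algebraMap R (FrobeniusTwist R p e) a ∈
      tensorAnnihilator R (FrobeniusTwist R p e) u := by
    intro a ha
    rw [mem_tensorAnnihilator, Algebra.algebraMap_eq_smul_one, TensorProduct.smul_tmul, hu a ha,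
      TensorProduct.tmul_zero]
  obtain ⟨k, hk⟩ := Ideal.exists_pow_le_of_le_radical_of_fg
    (I := maximalIdeal (FrobeniusTwist R p e)) (J := tensorAnnihilator R (FrobeniusTwist R p e) u)
    (fun a ha => ⟨p ^ e, by
      have h := key (show R from a) ha
      rwa [algebraMap_frobeniusTwist] at h⟩) (IsNoetherian.noetherian _)
  exact isFiniteLength_quotient_of_pow_le hk

/-- Nested ideals with residue modules of equal finite length are equal. -/
lemma _root_.Ideal.eq_of_le_of_length_quotient_eq {A : Type*} [CommRing A] {I J : Ideal A}
    (h : I ≤ J) (hfin : IsFiniteLength A (A ⧸ I))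
    (hl : Module.length A (A ⧸ I) = Module.length A (A ⧸ J)) : I = J := by
  obtain ⟨_, _⟩ := isFiniteLength_iff_isNoetherian_isArtinian.1 hfin
  by_contra hne
  have hmap : Submodule.map I.mkQ J ≠ ⊥ := by
    intro hb
    refine hne (le_antisymm h fun a ha => ?_)
    have := Submodule.mem_map_of_mem (f := I.mkQ) ha
    rw [hb, Submodule.mem_bot] at this
    exact (Submodule.Quotient.mk_eq_zero I).1 this
  have := Submodule.length_quotient_lt _ hmap
  rw [(Submodule.quotientQuotientEquivQuotient I J h).length_eq, hl] at this
  exact lt_irrefl _ this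

lemma mem_frobeniusColon {I : Ideal R} {v s : R} {e : ℕ} :
    s ∈ frobeniusColon p I v e ↔ v ^ p ^ e * s ∈ frobeniusPower p I e := by
  rw [frobeniusColon, Submodule.mem_colon_singleton, smul_eq_mul, mul_comm]

/-- For a cyclic module `R x` and `u = v x`, the annihilator of `1 ⊗ u` in `R^{(e)} ⊗ R x` is
`(ann(x)^{[q]} : v^q)`. -/
lemma mem_tensorAnnihilator_iff_mem_frobeniusColon {x u : M} {v : R} (hv : v • x = u)
    (hu : u ∈ Submodule.span R {x}) {e : ℕ} {s : R} :
    (show FrobeniusTwist R p e from s) ∈ tensorAnnihilator R (FrobeniusTwist R p e)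
      (⟨u, hu⟩ : Submodule.span R {x}) ↔ s ∈ frobeniusColon p (Ideal.torsionOf R M x) v e := by
  rw [mem_tensorAnnihilator_span_singleton hv, mem_frobeniusColon, algebraMap_frobeniusTwist]
  rfl

lemma exists_isSocleGenerator_chain [IsLocalRing R]
    (h : ∀ n, ∃ (I : Ideal R) (u : R), IsSocleGenerator I u ∧ I ≤ maximalIdeal R ^ n) :
    ∃ (I : ℕ → Ideal R) (u : ℕ → R), IsGorensteinSequence I ∧
      ∀ t, IsSocleGenerator (I t) (u t) := by
  choose G v hG hle using h
  choose k hk using fun n => (hG n).exists_pow_le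
  -- the indices are chosen so that `𝔪 ^ (n (t + 1)) ≤ G (n t)`
  let n : ℕ → ℕ := fun t => Nat.rec 0 (fun _ m => max (k m) (m + 1)) t
  have hn : ∀ t, n (t + 1) = max (k (n t)) (n t + 1) := fun t => rfl
  have hmono : StrictMono n := strictMono_nat_of_lt_succ fun t => by rw [hn]; omega
  refine ⟨fun t => G (n t), fun t => v (n t),
    ⟨fun t => (hG _).isIrreducibleMPrimary, antitone_nat_of_succ_le fun t => ?_, fun m =>
      ⟨m, (hle _).trans (Ideal.pow_le_pow_right (hmono.le_apply))⟩⟩, fun t => hG _⟩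
  refine (hle _).trans (le_trans (Ideal.pow_le_pow_right ?_) (hk (n t)))
  rw [hn]
  exact le_max_left _ _

variable [IsLocalRing R] [IsNoetherianRing R] {E : Type u} [AddCommGroup E] [Module R E]
  {ι : ResidueField R →ₗ[R] E}

/-- Equality of the lengths of the two kernels means equality of the annihilators of the socle
element in `R^{(e)} ⊗ E'` and `R^{(e)} ⊗ E`. -/
lemma kernelLength_eq_iff (hι : Function.Injective ι) {E' : Submodule R E} (hu : ι 1 ∈ E')
    (e : ℕ) :
    kernelLength p (LinearMap.range ι) e =
        kernelLength p ((LinearMap.range ι).submoduleOf E') e ↔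
      tensorAnnihilator R (FrobeniusTwist R p e) (ι 1) ≤
        tensorAnnihilator R (FrobeniusTwist R p e) (⟨ι 1, hu⟩ : E') := by
  have hsub : (LinearMap.range ι).submoduleOf E' = Submodule.span R {(⟨ι 1, hu⟩ : E')} := by
    rw [range_eq_span_map_one]
    ext ⟨y, hy⟩
    simp [Submodule.submoduleOf, Submodule.mem_span_singleton]
  have hle : tensorAnnihilator R (FrobeniusTwist R p e) (⟨ι 1, hu⟩ : E') ≤
      tensorAnnihilator R (FrobeniusTwist R p e) (ι 1) :=
    tensorAnnihilator_le_of_map E'.subtype _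
  rw [hsub, range_eq_span_map_one, kernelLength_span_singleton, kernelLength_span_singleton]
  constructor
  · intro hl
    refine (Ideal.eq_of_le_of_length_quotient_eq hle ?_ hl.symm).ge
    exact isFiniteLength_quotient_tensorAnnihilator p (fun a ha =>
      Subtype.ext ((smul_map_one_eq_zero_iff hι).2 ha)) e
  · intro h
    rw [le_antisymm h hle]

/-- Given a chain of ideals as in condition (A), `E` is the increasing union of the submodules
`R x_t ≃ R ⧸ I_t`; every finitely generated submodule lies in all but finitely many of them. -/
lemma exists_le_span_singleton (hι : IsInjectiveHull ι) {I : ℕ → Ideal R}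
    (hI : IsGorensteinSequence I) {x : ℕ → E} (hx : ∀ t, Ideal.torsionOf R E (x t) = I t)
    {N : Submodule R E} (hN : N.FG) : ∃ t₀, ∀ t, t₀ ≤ t → N ≤ Submodule.span R {x t} := by
  obtain ⟨S, rfl⟩ := hN
  -- `𝔪 ^ (n y)` kills `y`, so `I t` kills all generators once it lies in `𝔪 ^ (S.sup n)`
  choose n hn using hι.exists_pow_smul_eq_zero
  obtain ⟨t₀, ht₀⟩ := hI.cofinal (S.sup n)
  refine ⟨t₀, fun t ht => Submodule.span_le.2 fun y hy => ?_⟩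
  refine hι.mem_span_of_torsionOf_le ?_
  rw [hx]
  refine ((hI.antitone ht).trans ht₀).trans
    ((Ideal.pow_le_pow_right (Finset.le_sup (Finset.mem_coe.1 hy))).trans fun a ha => ?_)
  exact (Ideal.mem_torsionOf_iff y a).2 (hn y a ha)

/-- Condition (A) implies condition (B), with `E' = R x_{t₀}`. -/
lemma ConditionA.conditionB (hι : IsInjectiveHull ι) (h : ConditionA R p) :
    ConditionB p ι := by
  obtain ⟨I, u, hI, hu, t₀, ht₀⟩ := h
  choose x hx hux using fun t =>
    ((hI.irreducible_primary t).isSocleGenerator (hu t)).exists_torsionOf_eq hι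
  have hmem : ∀ t, ι 1 ∈ Submodule.span R {x t} := fun t =>
    Submodule.mem_span_singleton.2 ⟨u t, hux t⟩
  refine ⟨Submodule.span R {x t₀}, ?_, ?_, fun e => ?_⟩
  · rw [range_eq_span_map_one, Submodule.span_singleton_le_iff_mem]
    exact hmem t₀
  · obtain ⟨k, hk⟩ := hι.exists_pow_smul_eq_zero (x t₀)
    exact (Ideal.quotTorsionOfEquivSpanSingleton R E (x t₀)).isFiniteLength
      (isFiniteLength_quotient_of_pow_le fun a ha => (Ideal.mem_torsionOf_iff _ a).2 (hk a ha))
  · rw [kernelLength_eq_iff p hι.injective (hmem t₀)]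
    intro s hs
    obtain ⟨N, huN, hN, hsN⟩ := exists_fg_mem_tensorAnnihilator hs
    obtain ⟨t₁, ht₁⟩ := exists_le_span_singleton hι hI hx hN
    have h1 := tensorAnnihilator_mono (ht₁ (max t₀ t₁) (le_max_right _ _)) huN hsN
    have h2 := (mem_tensorAnnihilator_iff_mem_frobeniusColon p (hux _) (hmem _)).1 h1
    rw [hx, ht₀ _ (le_max_left _ _), ← hx] at h2
    exact (mem_tensorAnnihilator_iff_mem_frobeniusColon p (hux _) (hmem _)).2 h2

/-- If `𝔪`-primary irreducible ideals exist inside all powers of `𝔪`, then condition (B) implies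
condition (A). -/
lemma ConditionB.conditionA (hι : IsInjectiveHull ι)
    (hR : ∀ n, ∃ (I : Ideal R) (u : R), IsSocleGenerator I u ∧ I ≤ maximalIdeal R ^ n)
    (h : ConditionB p ι) : ConditionA R p := by
  obtain ⟨E', hιE', hE', hlen⟩ := h
  obtain ⟨I, u, hI, hu⟩ := exists_isSocleGenerator_chain hR
  choose x hx hux using fun t => (hu t).exists_torsionOf_eq hι
  have hmem : ∀ t, ι 1 ∈ Submodule.span R {x t} := fun t =>
    Submodule.mem_span_singleton.2 ⟨u t, hux t⟩
  have hE'fg : E'.FG := by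
    obtain ⟨_, _⟩ := isFiniteLength_iff_isNoetherian_isArtinian.1 hE'
    exact Module.Finite.iff_fg.1 inferInstance
  obtain ⟨t₀, ht₀⟩ := exists_le_span_singleton hι hI hx hE'fg
  have hu' : ι 1 ∈ E' := hιE' ⟨1, rfl⟩
  -- for `t ≥ t₀` the colon ideal is the annihilator of the socle element in `R^{(e)} ⊗ E`
  have key : ∀ t, t₀ ≤ t → ∀ e s, s ∈ frobeniusColon p (I t) (u t) e ↔
      (show FrobeniusTwist R p e from s) ∈ tensorAnnihilator R (FrobeniusTwist R p e) (ι 1) := by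
    intro t ht e s
    rw [← hx t, ← mem_tensorAnnihilator_iff_mem_frobeniusColon p (hux t) (hmem t)]
    constructor
    · exact fun hs => tensorAnnihilator_le_of_map (Submodule.span R {x t}).subtype
        ⟨ι 1, hmem t⟩ hs
    · exact fun hs => tensorAnnihilator_mono (ht₀ t ht) hu'
        ((kernelLength_eq_iff p hι.injective hu' e).1 (hlen e) hs)
  refine ⟨I, u, hI, fun t => (hu t).representsSocle, t₀, fun t ht e => ?_⟩
  ext s
  rw [key t ht, key t₀ le_rfl]

end KernelLength

/-! ### `F`-finite rings -/

section FFinite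

variable {R : Type u} [CommRing R] (p : ℕ) [ExpChar R p]

/-- The identity map from `R` to the ring underlying the bimodule `R^{(e)}`. -/
def toTwist (R : Type u) [CommRing R] (p e : ℕ) : R ≃+* FrobeniusTwist R p e :=
  RingEquiv.refl R

lemma smul_toTwist {e : ℕ} (r x : R) :
    r • toTwist R p e x = toTwist R p e (r ^ p ^ e * x) := by
  rw [Algebra.smul_def, algebraMap_frobeniusTwist]
  rfl

lemma ffinite_iff_finite_frobeniusTwist :
    FFinite R p ↔ Module.Finite R (FrobeniusTwist R p 1) := by
  change _ ↔ (iterateFrobenius R p 1).Finite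
  rw [iterateFrobenius_one]
  rfl

/-- `R` is `F`-finite if and only if it is finitely generated over its subring of `p`-th powers. -/
lemma ffinite_iff : FFinite R p ↔
    ∃ (n : ℕ) (f : Fin n → R), ∀ x, ∃ a : Fin n → R, x = ∑ j, a j ^ p * f j := by
  have key : ∀ {n : ℕ} (f : Fin n → R),
      Submodule.span R (Set.range fun j => toTwist R p 1 (f j)) = ⊤ ↔
        ∀ x, ∃ a : Fin n → R, x = ∑ j, a j ^ p * f j := by
    intro n f
    rw [Submodule.eq_top_iff', (toTwist R p 1).surjective.forall]
    refine forall_congr' fun x => ?_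
    rw [Submodule.mem_span_range_iff_exists_fun]
    refine exists_congr fun a => ?_
    simp_rw [smul_toTwist, pow_one, ← map_sum]
    rw [(toTwist R p 1).injective.eq_iff, eq_comm]
  rw [ffinite_iff_finite_frobeniusTwist]
  constructor
  · intro h
    obtain ⟨n, f, hf⟩ := Module.Finite.exists_fin (R := R) (M := FrobeniusTwist R p 1)
    exact ⟨n, fun j => (toTwist R p 1).symm (f j), (key _).1 (by simpa using hf)⟩
  · rintro ⟨n, f, hf⟩
    exact Module.finite_def.2
      (Submodule.fg_iff_exists_fin_generating_family.2 ⟨n, _, (key f).2 hf⟩)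

variable {p}

lemma FFinite.of_surjective (h : FFinite R p) {S : Type u} [CommRing S] [ExpChar S p] (f : R →+* S)
    (hf : Function.Surjective f) : FFinite S p := by
  have h1 : (f.comp (frobenius R p)).Finite := RingHom.Finite.comp (.of_surjective f hf) h
  have h2 : f.comp (frobenius R p) = (frobenius S p).comp f :=
    RingHom.ext fun x => by simp [frobenius_def]
  rw [h2] at h1
  exact RingHom.Finite.of_comp_finite h1

lemma FFinite.of_isFractionRing [IsDomain R] (h : FFinite R p) (K : Type u) [Field K] [Algebra R K]
    [IsFractionRing R K] [ExpChar K p] : FFinite K p := by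
  obtain ⟨n, f, hf⟩ := (ffinite_iff p).1 h
  refine (ffinite_iff p).2 ⟨n, fun j => algebraMap R K (f j), fun x => ?_⟩
  obtain ⟨a, b, hb, rfl⟩ := IsFractionRing.div_surjective (A := R) x
  have hb0 : algebraMap R K b ≠ 0 := by
    simpa using nonZeroDivisors.ne_zero hb
  obtain ⟨c, hc⟩ := hf (a * b ^ (p - 1))
  refine ⟨fun j => algebraMap R K (c j) / algebraMap R K b, ?_⟩
  have h1 : algebraMap R K a / algebraMap R K b =
      algebraMap R K (a * b ^ (p - 1)) / algebraMap R K b ^ p := by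
    rw [div_eq_div_iff hb0 (pow_ne_zero _ hb0), map_mul, map_pow, mul_assoc,
      pow_sub_one_mul (expChar_pos R p).ne']
  rw [h1, hc, map_sum, Finset.sum_div]
  refine Finset.sum_congr rfl fun j _ => ?_
  rw [map_mul, map_pow, div_pow]
  ring

end FFinite

/-! ### Cartier maps and test elements -/

/-- The `K`-dual of a finite field extension `L / K` is one-dimensional over `L`. -/
lemma exists_eq_apply_mul {K L : Type*} [Field K] [CommRing L] [IsDomain L] [Algebra K L]
    [Module.Finite K L] {φ : L →ₗ[K] K} (hφ : φ ≠ 0) (ψ : L →ₗ[K] K) :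
    ∃ a, ∀ x, ψ x = φ (a * x) := by
  let Φ : L →ₗ[K] Module.Dual K L := (LinearMap.mul K L).compr₂ φ
  have hΦ : Function.Injective Φ := by
    rw [injective_iff_map_eq_zero]
    intro a ha
    by_contra ha0
    apply hφ
    have hinj : Function.Injective (LinearMap.mulLeft K a) := fun x y h =>
      mul_left_cancel₀ ha0 h
    ext y
    obtain ⟨x, rfl⟩ := LinearMap.injective_iff_surjective.1 hinj y
    exact LinearMap.congr_fun ha x
  obtain ⟨a, ha⟩ := (LinearMap.injective_iff_surjective_of_finrank_eq_finrank
    (Subspace.dual_finrank_eq (K := K) (V := L)).symm).1 hΦ ψ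
  exact ⟨a, fun x => (LinearMap.congr_fun ha x).symm⟩

/-- An additive map `π` with `π (r ^ p * x) = r * π x`, that is, an `R`-linear map from
`R^{(1)}`, an `R`-module through Frobenius, to `R`. -/
def IsCartierMap {R : Type*} [CommRing R] (p : ℕ) (π : R →+ R) : Prop :=
  ∀ r x, π (r ^ p * x) = r * π x

lemma IsCartierMap.iterate {R : Type*} [CommRing R] {p : ℕ} {π : R →+ R} (hπ : IsCartierMap p π)
    (b : ℕ) (r x : R) : π^[b] (r ^ p ^ b * x) = r * π^[b] x := by
  induction b generalizing x with
  | zero => simp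
  | succ b ih =>
    rw [Function.iterate_succ_apply, Function.iterate_succ_apply, pow_succ, pow_mul, hπ, ih]

/-- Over an `F`-finite field there is a nonzero Cartier map `φ` together with dual bases for the
pairing `(x, y) ↦ φ (x * y)`. -/
lemma exists_isCartierMap_dualBasis {K : Type u} [Field K] {p : ℕ} [ExpChar K p]
    (h : FFinite K p) : ∃ φ : K →+ K, IsCartierMap p φ ∧ ∃ (n : ℕ) (b b' : Fin n → K),
      ∀ x, x = ∑ i, φ (b' i * x) ^ p * b i := by
  have : IsDomain (FrobeniusTwist K p 1) := inferInstanceAs (IsDomain K)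
  have := (ffinite_iff_finite_frobeniusTwist p).1 h
  let B := Module.finBasis K (FrobeniusTwist K p 1)
  have hpos : 0 < Module.finrank K (FrobeniusTwist K p 1) := Module.finrank_pos
  let φ := B.coord ⟨0, hpos⟩
  have hφ : φ ≠ 0 := fun h0 => by
    have := LinearMap.congr_fun h0 (B ⟨0, hpos⟩)
    simp [φ] at this
  choose b' hb' using fun i => exists_eq_apply_mul hφ (B.coord i)
  let T := toTwist K p 1
  refine ⟨φ.toAddMonoidHom.comp (T : K →+ FrobeniusTwist K p 1), fun r x => ?_, _,
    fun i => T.symm (B i), fun i => T.symm (b' i), fun x => T.injective ?_⟩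
  · change φ (T (r ^ p * x)) = r * φ (T x)
    rw [← smul_eq_mul r, ← map_smul φ, smul_toTwist, pow_one]
  · rw [map_sum, ← B.sum_repr (T x)]
    refine Finset.sum_congr rfl fun i _ => ?_
    change _ = T (φ (T (T.symm (b' i) * x)) ^ p * T.symm (B i))
    rw [T.map_mul (T.symm (b' i)), T.apply_symm_apply, ← hb', B.coord_apply]
    nth_rw 1 [← T.apply_symm_apply (B i)]
    rw [smul_toTwist, pow_one]

/-- Over an `F`-finite domain there is a Cartier map `π` for which, up to a nonzero multiple `C`,
every `x` lies in the ideal generated by the `p`-th powers of the elements of `π (x R)`. -/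
lemma exists_isCartierMap_mul_mem_span {R : Type u} [CommRing R] [IsDomain R] {p : ℕ}
    [ExpChar R p] (h : FFinite R p) : ∃ π : R →+ R, IsCartierMap p π ∧ ∃ C ≠ 0,
      ∀ x, C * x ∈ Ideal.span (Set.range fun r => π (r * x) ^ p) := by
  let K := FractionRing R
  have hinj : Function.Injective (algebraMap R K) := IsFractionRing.injective R K
  have : ExpChar K p := expChar_of_injective_algebraMap hinj p
  obtain ⟨φ, hφ, n, b, b', hb⟩ := exists_isCartierMap_dualBasis (h.of_isFractionRing K)
  obtain ⟨m, f, hf⟩ := (ffinite_iff p).1 h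
  -- a denominator `g` of `φ` on `R`
  obtain ⟨g, hg⟩ := IsLocalization.exist_integer_multiples (nonZeroDivisors R) Finset.univ
    fun j => φ (algebraMap R K (f j))
  have hgR : ∀ x, ∃ y, algebraMap R K y = algebraMap R K g * φ (algebraMap R K x) := by
    intro x
    obtain ⟨a, rfl⟩ := hf x
    choose y hy using fun j => hg j (Finset.mem_univ j)
    simp only [Algebra.smul_def] at hy
    refine ⟨∑ j, a j * y j, ?_⟩
    rw [map_sum, map_sum, map_sum, Finset.mul_sum]
    refine Finset.sum_congr rfl fun j _ => ?_
    rw [map_mul, hy, map_mul, map_pow, hφ]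
    ring
  choose π hπ using hgR
  -- a common denominator `c` of the dual bases
  obtain ⟨c₁, hc₁⟩ := IsLocalization.exist_integer_multiples (nonZeroDivisors R) Finset.univ b
  obtain ⟨c₂, hc₂⟩ := IsLocalization.exist_integer_multiples (nonZeroDivisors R) Finset.univ b'
  choose β hβ using fun i => hc₁ i (Finset.mem_univ i)
  choose β' hβ' using fun i => hc₂ i (Finset.mem_univ i)
  simp only [Algebra.smul_def] at hβ hβ'
  have hp : p ≠ 0 := (expChar_pos R p).ne'
  refine ⟨⟨⟨π, hinj ?_⟩, fun x y => hinj ?_⟩, fun r x => hinj ?_, (g * c₂) ^ p * c₁, ?_,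
    fun x => ?_⟩
  · rw [hπ, map_zero, map_zero, mul_zero]
  · rw [map_add, hπ, hπ, hπ, map_add, map_add, mul_add]
  · change algebraMap R K (π (r ^ p * x)) = algebraMap R K (r * π x)
    rw [hπ, map_mul, map_mul _ r, hπ, map_pow, hφ]
    ring
  · exact nonZeroDivisors.ne_zero (mul_mem (pow_mem (mul_mem g.2 c₂.2) p) c₁.2)
  · have hx : (g * c₂ : R) ^ p * c₁ * x =
        ∑ i, β i * π (c₂ ^ (p - 1) * β' i * x) ^ p := by
      apply hinj
      rw [map_mul, hb (algebraMap R K x), Finset.mul_sum, map_sum]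
      refine Finset.sum_congr rfl fun i _ => ?_
      have h1 : algebraMap R K (c₂ ^ (p - 1) * β' i * x) =
          algebraMap R K c₂ ^ p * (b' i * algebraMap R K x) := by
        rw [map_mul, map_mul, hβ', map_pow,
          ← pow_sub_one_mul hp (algebraMap R K c₂)]
        ring
      rw [map_mul _ (β i), map_pow _ (π _), hπ, h1, hφ, hβ, map_mul, map_pow, map_mul]
      ring
    rw [AddMonoidHom.coe_mk, ZeroHom.coe_mk, hx]
    exact Ideal.sum_mem _ fun i _ => Ideal.mul_mem_left _ _ (Ideal.subset_span ⟨_, rfl⟩)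

/-- A nonzero `π`-stable ideal `J` contains a power of `C`: up to powers of `C`, it is contained in
all of its own powers, so Krull's intersection theorem in the localization away from `C` shows
that `J` becomes the unit ideal there. -/
lemma exists_pow_mem_of_isCartierMap {R : Type u} [CommRing R] [IsDomain R] [IsNoetherianRing R]
    {p : ℕ} [ExpChar R p] [Fact p.Prime] {π : R →+ R} {C : R}
    (hC : ∀ x, C * x ∈ Ideal.span (Set.range fun r => π (r * x) ^ p)) (hC0 : C ≠ 0)
    {J : Ideal R} (hJ : ∀ x ∈ J, π x ∈ J) {d : R} (hd : d ∈ J) (hd0 : d ≠ 0) :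
    ∃ k, C ^ k ∈ J := by
  have hpow : ∀ e, ∃ k, ∀ x ∈ J, C ^ k * x ∈ J ^ p ^ e := by
    intro e
    induction e with
    | zero => exact ⟨0, fun x hx => by simpa using hx⟩
    | succ e ih =>
      obtain ⟨k, hk⟩ := ih
      refine ⟨p * k + 1, fun x hx => ?_⟩
      rw [pow_succ C, mul_assoc]
      refine Submodule.span_induction (p := fun y _ => C ^ (p * k) * y ∈ J ^ p ^ (e + 1))
        ?_ ?_ ?_ ?_ (hC x)
      · rintro _ ⟨r, rfl⟩
        have := Ideal.pow_mem_pow (hk _ (hJ _ (J.mul_mem_left r hx))) p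
        rwa [mul_pow, ← pow_mul, ← pow_mul, mul_comm k, ← pow_succ] at this
      · simp
      · intro x y _ _ hx hy
        rw [mul_add]
        exact add_mem hx hy
      · intro a x _ hx
        rw [smul_eq_mul, mul_left_comm]
        exact Ideal.mul_mem_left _ a hx
  let L := Localization.Away C
  have : IsDomain L := IsLocalization.isDomain_localization
    (powers_le_nonZeroDivisors_of_noZeroDivisors hC0)
  have hinj : Function.Injective (algebraMap R L) := IsLocalization.injective L
    (powers_le_nonZeroDivisors_of_noZeroDivisors hC0)
  by_contra! hJC
  have hne : J.map (algebraMap R L) ≠ ⊤ := by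
    rw [IsLocalization.map_algebraMap_ne_top_iff_disjoint (Submonoid.powers C), Set.disjoint_left]
    rintro _ ⟨k, rfl⟩ h
    exact hJC k h
  have : IsNoetherianRing L := IsLocalization.isNoetherianRing (Submonoid.powers C) L inferInstance
  have hmem : algebraMap R L d ∈ ⨅ n, J.map (algebraMap R L) ^ n := by
    rw [Ideal.mem_iInf]
    intro n
    obtain ⟨k, hk⟩ := hpow n
    have h1 := Ideal.mem_map_of_mem (algebraMap R L) (hk d hd)
    rw [map_mul, map_pow, Ideal.unit_mul_mem_iff_mem _
      ((IsLocalization.Away.algebraMap_isUnit C).pow k), Ideal.map_pow] at h1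
    exact Ideal.pow_le_pow_right (Nat.lt_pow_self (Fact.out : p.Prime).one_lt).le h1
  rw [Ideal.iInf_pow_eq_bot_of_isDomain _ hne] at hmem
  exact hd0 ((map_eq_zero_iff _ hinj).1 hmem)

/-- A **test element** `c` for a Cartier map `π` of an `F`-finite Noetherian domain: if `J` contains
all `π^b (d R)`, `d ≠ 0`, then it contains `c`; moreover `c` is a value of every iterate of `π`. -/
lemma exists_testElement {R : Type u} [CommRing R] [IsDomain R] [IsNoetherianRing R]
    {p : ℕ} [ExpChar R p] [Fact p.Prime] (h : FFinite R p) :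
    ∃ π : R →+ R, IsCartierMap p π ∧ ∃ c ≠ 0, (∀ b, ∃ r, π^[b] r = c) ∧
      ∀ (J : Ideal R) (d : R), d ≠ 0 → (∀ b r, π^[b] (r * d) ∈ J) → c ∈ J := by
  obtain ⟨π, hπ, C, hC0, hC⟩ := exists_isCartierMap_mul_mem_span h
  have hp : p.Prime := Fact.out
  -- `π ≠ 0`
  obtain ⟨r₀, hr₀⟩ : ∃ r₀, π r₀ ≠ 0 := by
    by_contra! h0
    have h1 := hC 1
    simp only [h0, zero_pow hp.ne_zero] at h1
    rw [Set.range_const, Ideal.span_singleton_eq_bot.2 rfl, Submodule.mem_bot, mul_one] at h1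
    exact hC0 h1
  set c₁ := π r₀ with hc₁
  -- the square makes the induction work: `π (c₁ ^ p * r₀) = c₁ * π r₀ = c₁ ^ 2`, where `2 ≤ p`
  have hval : ∀ b, ∃ r, π^[b] r = c₁ ^ 2 := by
    intro b
    induction b with
    | zero => exact ⟨_, rfl⟩
    | succ b ih =>
      obtain ⟨r, hr⟩ := ih
      refine ⟨(r₀ * c₁ ^ (p - 2)) ^ p ^ b * r, ?_⟩
      have : r₀ * c₁ ^ (p - 2) * c₁ ^ 2 = c₁ ^ p * r₀ := by
        rw [mul_assoc, ← pow_add, Nat.sub_add_cancel hp.two_le, mul_comm]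
      rw [Function.iterate_succ_apply', hπ.iterate, hr, this, hπ, ← hc₁, sq]
  refine ⟨π, hπ, C * c₁ ^ 2, mul_ne_zero hC0 (pow_ne_zero 2 hr₀), fun b => ?_, ?_⟩
  · obtain ⟨r, hr⟩ := hval b
    exact ⟨C ^ p ^ b * r, by rw [hπ.iterate, hr]⟩
  · intro J' d hd hJ'
    let J : Ideal R := Ideal.span {y | ∃ b r, y = π^[b] (r * d)}
    have hJle : J ≤ J' := Ideal.span_le.2 (by rintro _ ⟨b, r, rfl⟩; exact hJ' b r)
    have hJπ : ∀ x ∈ J, π x ∈ J := by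
      suffices ∀ x ∈ J, ∀ r, π (r * x) ∈ J from fun x hx => by simpa using this x hx 1
      intro x hx
      refine Submodule.span_induction (p := fun x _ => ∀ r, π (r * x) ∈ J) ?_ ?_ ?_ ?_ hx
      · rintro _ ⟨b, s, rfl⟩ r
        refine Ideal.subset_span ⟨b + 1, r ^ p ^ b * s, ?_⟩
        rw [mul_assoc, Function.iterate_succ_apply', hπ.iterate]
      · simp
      · intro x y _ _ hx hy r
        rw [mul_add, map_add]
        exact J.add_mem (hx r) (hy r)
      · intro a x _ hx r
        rw [smul_eq_mul, ← mul_assoc]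
        exact hx _
    have hdJ : d ∈ J := Ideal.subset_span ⟨0, 1, by simp⟩
    obtain ⟨k, hk⟩ := exists_pow_mem_of_isCartierMap hC hC0 hJπ hdJ hd
    obtain ⟨r, hr⟩ := hval k
    apply hJle
    rw [← hr, ← hπ.iterate]
    have hiter : ∀ b, ∀ x ∈ J, π^[b] x ∈ J := by
      intro b
      induction b with
      | zero => exact fun x hx => hx
      | succ b ih => exact fun x hx => ih _ (hJπ x hx)
    refine hiter k _ (J.mul_mem_right r (J.pow_mem_of_pow_mem hk ?_))
    exact (Nat.lt_pow_self hp.one_lt).le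

/-! ### Pullbacks of irreducible ideals under Cartier maps -/

lemma expChar_of_ringHom {R S : Type*} [CommRing R] [CommRing S] [Nontrivial S] (f : R →+* S)
    (p : ℕ) [hp : Fact p.Prime] [h : ExpChar R p] : ExpChar S p := by
  cases h with
  | zero => exact absurd hp.out Nat.not_prime_one
  | prime _ =>
    have : CharP S p := (CharP.charP_iff_prime_eq_zero hp.out).2 (by
      rw [← map_natCast f, CharP.cast_eq_zero, map_zero])
    exact .prime hp.out

section Pullback

variable {R : Type u} [CommRing R] {p : ℕ} {π : R →+ R}

/-- The largest ideal that the additive map `π` maps into `I`. -/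
def cartierPullback (π : R →+ R) (I : Ideal R) : Ideal R where
  carrier := {s | ∀ r, π (r * s) ∈ I}
  zero_mem' r := by simp
  add_mem' ha hb r := by
    rw [mul_add, map_add]
    exact I.add_mem (ha r) (hb r)
  smul_mem' c s hs r := by
    rw [smul_eq_mul, ← mul_assoc]
    exact hs _

lemma mem_cartierPullback {I : Ideal R} {s : R} :
    s ∈ cartierPullback π I ↔ ∀ r, π (r * s) ∈ I := Iff.rfl

lemma mem_iterate_cartierPullback (hπ : IsCartierMap p π) {I : Ideal R} (e : ℕ) {s : R} :
    s ∈ (cartierPullback π)^[e] I ↔ ∀ r, π^[e] (r * s) ∈ I := by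
  induction e generalizing s with
  | zero =>
    exact ⟨fun h r => I.mul_mem_left r h, fun h => by simpa using h 1⟩
  | succ e ih =>
    rw [Function.iterate_succ_apply', mem_cartierPullback]
    simp_rw [ih, Function.iterate_succ_apply]
    constructor
    · intro h r
      simpa using h r 1
    · intro h r r'
      rw [← hπ, ← mul_assoc]
      exact h _

lemma IsCartierMap.pow_mem_cartierPullback (hπ : IsCartierMap p π) {I : Ideal R} {a : R}
    (ha : a ∈ I) : a ^ p ∈ cartierPullback π I := fun r => by
  rw [mul_comm, hπ]
  exact I.mul_mem_right _ ha

variable [IsLocalRing R] {I : Ideal R} {u : R}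

lemma IsSocleGenerator.mem_maximalIdeal_of_mul_mem (h : IsSocleGenerator I u) {c : R}
    (hc : c * u ∈ I) : c ∈ maximalIdeal R := by
  rw [mem_maximalIdeal]
  intro hcu
  exact h.notMem ((Ideal.unit_mul_mem_iff_mem I hcu).1 hc)

lemma IsSocleGenerator.exists_sub_mul_mem (h : IsSocleGenerator I u) {y : R}
    (hy : ∀ a ∈ maximalIdeal R, a * y ∈ I) : ∃ c, y - c * u ∈ I := by
  by_cases hyI : y ∈ I
  · exact ⟨0, by simpa using hyI⟩
  obtain ⟨v, hv⟩ := h.exists_mul_sub_mem y hyI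
  have hvu : IsUnit v := by
    by_contra hv'
    have := I.sub_mem (hy v ((mem_maximalIdeal v).2 hv')) hv
    exact h.notMem (by simpa using this)
  obtain ⟨c, hc⟩ := hvu.exists_left_inv
  refine ⟨c, ?_⟩
  have : y - c * u = c * (v * y - u) := by linear_combination (-y) * hc
  rw [this]
  exact I.mul_mem_left c hv

/-- A socle element `s` of `R ⧸ cartierPullback π I` induces the functional `r ↦ π (r * s)` on the
residue field, with values in the socle of `R ⧸ I`, which is identified with the residue field. -/
lemma IsSocleGenerator.exists_functional [ExpChar (ResidueField R) p] (hI : IsSocleGenerator I u)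
    (hπ : IsCartierMap p π) {s : R} (hs : RepresentsSocle (cartierPullback π I) s) :
    ∃ φ : FrobeniusTwist (ResidueField R) p 1 →ₗ[ResidueField R] ResidueField R,
      ∀ r c, π (r * s) - c * u ∈ I → φ (toTwist _ p 1 (residue R r)) = residue R c := by
  let T := toTwist (ResidueField R) p 1
  have hex : ∀ r, ∃ c, π (r * s) - c * u ∈ I := fun r => hI.exists_sub_mul_mem fun a ha => by
    have hp : p ≠ 0 := (expChar_pos (ResidueField R) p).ne'
    rw [← hπ, mul_left_comm]
    exact hs.mul_mem _ (Ideal.pow_mem_of_mem _ ha p (Nat.pos_of_ne_zero hp)) r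
  choose c hc using hex
  have huniq : ∀ r r' a a', residue R r = residue R r' → π (r * s) - a * u ∈ I →
      π (r' * s) - a' * u ∈ I → residue R a = residue R a' := by
    intro r r' a a' hr ha ha'
    have h1 : π ((r - r') * s) ∈ I := by
      have hm : r - r' ∈ maximalIdeal R := by
        rw [← residue_eq_zero_iff, map_sub, hr, sub_self]
      have := hs.mul_mem _ hm 1
      rwa [one_mul] at this
    rw [sub_mul, map_sub] at h1
    rw [← sub_eq_zero, ← map_sub, residue_eq_zero_iff]
    apply hI.mem_maximalIdeal_of_mul_mem
    have := I.add_mem (I.sub_mem h1 ha) ha'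
    convert this using 1
    ring
  let σ : ResidueField R → R := Function.surjInv residue_surjective
  have hσ : ∀ x, residue R (σ x) = x := Function.surjInv_eq residue_surjective
  have key : ∀ r a, π (r * s) - a * u ∈ I →
      residue R (c (σ (T.symm (T (residue R r))))) = residue R a := fun r a ha =>
    huniq _ r _ a (by rw [hσ, T.symm_apply_apply]) (hc _) ha
  have hsurj : ∀ x, ∃ r, T (residue R r) = x :=
    (T.surjective.comp residue_surjective)
  refine ⟨{ toFun := fun x => residue R (c (σ (T.symm x))), map_add' := ?_, map_smul' := ?_ },
    key⟩
  · intro x y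
    obtain ⟨r, rfl⟩ := hsurj x
    obtain ⟨r', rfl⟩ := hsurj y
    rw [← map_add T, ← map_add (residue R), key _ _ (hc r), key _ _ (hc r'), ← map_add]
    refine key _ _ ?_
    have := I.add_mem (hc r) (hc r')
    rw [add_mul, map_add, add_mul]
    convert this using 1
    ring
  · intro a x
    obtain ⟨r, rfl⟩ := hsurj x
    obtain ⟨a, rfl⟩ := residue_surjective a
    rw [smul_toTwist, pow_one, ← map_pow, ← map_mul (residue R), key _ _ (hc r), RingHom.id_apply,
      smul_eq_mul, ← map_mul]
    refine key _ _ ?_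
    have := I.mul_mem_left a (hc r)
    rw [mul_assoc, hπ]
    convert this using 1
    ring

/-- The pullback of an irreducible `𝔪`-primary ideal under a Cartier map is irreducible: its socle
embeds into the dual of `k^{(1)}`, which is one-dimensional. -/
lemma IsSocleGenerator.cartierPullback [IsNoetherianRing R] [ExpChar R p]
    [ExpChar (ResidueField R) p] (hF : FFinite R p) (hI : IsSocleGenerator I u)
    (hπ : IsCartierMap p π) (hne : cartierPullback π I ≠ ⊤) :
    ∃ v, IsSocleGenerator (cartierPullback π I) v := by
  have := (ffinite_iff_finite_frobeniusTwist p).1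
    (hF.of_surjective (residue R) residue_surjective)
  have : IsDomain (FrobeniusTwist (ResidueField R) p 1) :=
    inferInstanceAs (IsDomain (ResidueField R))
  have hp : 0 < p := expChar_pos R p
  refine exists_isSocleGenerator hne ?_ fun s s' hs hs' => ?_
  · obtain ⟨k, hk⟩ := hI.exists_pow_le
    refine Ideal.exists_pow_le_of_le_radical_of_fg (fun a ha => ⟨k * p, ?_⟩)
      (IsNoetherian.noetherian _)
    rw [pow_mul]
    exact hπ.pow_mem_cartierPullback (hk (Ideal.pow_mem_pow ha k))
  · obtain ⟨φ, hφ⟩ := hI.exists_functional hπ hs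
    obtain ⟨ψ, hψ⟩ := hI.exists_functional hπ hs'
    have hex : ∀ {s}, RepresentsSocle (FSignature.cartierPullback π I) s → ∀ r,
        ∃ c, π (r * s) - c * u ∈ I := fun hs r => hI.exists_sub_mul_mem fun a ha => by
      rw [← hπ, mul_left_comm]
      exact hs.mul_mem _ (Ideal.pow_mem_of_mem _ ha p hp) r
    have hφ0 : φ ≠ 0 := by
      rintro rfl
      refine hs.notMem fun r => ?_
      obtain ⟨c, hc⟩ := hex hs r
      have hcm : c ∈ maximalIdeal R := by
        rw [← residue_eq_zero_iff, ← hφ r c hc, LinearMap.zero_apply]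
      simpa using I.add_mem hc (hI.mul_mem hcm)
    -- the functional of `s'` is that of `s` composed with multiplication by a lift `a`
    obtain ⟨a, ha⟩ := exists_eq_apply_mul hφ0 ψ
    obtain ⟨a, rfl⟩ := ((toTwist _ p 1).surjective.comp residue_surjective) a
    refine ⟨a, fun r => ?_⟩
    obtain ⟨c, hc⟩ := hex hs (r * a)
    obtain ⟨c', hc'⟩ := hex hs' r
    have hcc : c - c' ∈ maximalIdeal R := by
      rw [← residue_eq_zero_iff, map_sub, ← hφ _ _ hc, ← hψ _ _ hc', ha, Function.comp_apply,
        ← map_mul, ← map_mul, mul_comm, sub_self]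
    have := I.add_mem (I.sub_mem hc hc') (hI.mul_mem hcc)
    rw [mul_sub, map_sub, ← mul_assoc]
    convert this using 1
    ring

/-- An ideal maximal among those that contain `𝔪 ^ n` but not `x` has its simple socle generated
by `x`. -/
lemma exists_isSocleGenerator_of_ne_zero [IsNoetherianRing R] {x : R} (hx : x ≠ 0) :
    ∃ J : Ideal R, IsSocleGenerator J x := by
  obtain ⟨n, hn⟩ : ∃ n, x ∉ maximalIdeal R ^ n := by
    by_contra! h
    have : x ∈ ⨅ n, maximalIdeal R ^ n := Ideal.mem_iInf.2 h
    rw [Ideal.iInf_pow_eq_bot_of_isLocalRing _ (Ideal.IsPrime.ne_top inferInstance)] at this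
    exact hx this
  obtain ⟨J, ⟨hJn, hJx⟩, hmax⟩ := set_has_maximal_iff_noetherian.2
    (inferInstance : IsNoetherian R R) {J : Ideal R | maximalIdeal R ^ n ≤ J ∧ x ∉ J}
    ⟨_, le_rfl, hn⟩
  refine ⟨J, ⟨n, hJn⟩, hJx, fun s hs => ?_⟩
  by_contra! h
  refine hmax (J ⊔ Ideal.span {s}) ⟨hJn.trans le_sup_left, fun hxs => ?_⟩ ?_
  · obtain ⟨j, hj, y, hy, rfl⟩ := Submodule.mem_sup.1 hxs
    obtain ⟨r, rfl⟩ := Ideal.mem_span_singleton'.1 hy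
    exact h r (by simpa using J.neg_mem hj)
  · refine lt_of_le_of_ne le_sup_left fun heq => hs ?_
    rw [heq]
    exact Ideal.mem_sup_right (Ideal.mem_span_singleton_self s)

end Pullback

lemma IsSocleGenerator.comap {S B : Type*} [CommRing S] [IsLocalRing S] [CommRing B]
    [IsLocalRing B] {f : S →+* B} (hf : Function.Surjective f) {I : Ideal B} {u : B}
    (h : IsSocleGenerator I u) : ∃ v, IsSocleGenerator (I.comap f) v := by
  obtain ⟨v, rfl⟩ := hf u
  refine ⟨v, ?_, h.notMem, fun s hs => ?_⟩
  · obtain ⟨k, hk⟩ := h.exists_pow_le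
    refine ⟨k, Ideal.map_le_iff_le_comap.1 ?_⟩
    rw [Ideal.map_pow]
    have := IsLocalHom.of_surjective f hf
    exact (Ideal.pow_right_mono (((local_hom_TFAE f).out 0 2).1 this) k).trans hk
  · obtain ⟨r, hr⟩ := h.exists_mul_sub_mem _ hs
    obtain ⟨r, rfl⟩ := hf r
    exact ⟨r, by rwa [Ideal.mem_comap, map_sub, map_mul]⟩

/-! ### Complete local rings -/

section Complete

variable {S : Type u} [CommRing S] [IsLocalRing S] [IsNoetherianRing S]

/-- **Chevalley's theorem**: in a complete local ring, if no member of a decreasing sequence of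
ideals `J e`, each containing a power of the maximal ideal, lies in the open ideal `Q`, then
neither does their intersection. -/
lemma exists_notMem_forall_mem_of_antitone [IsAdicComplete (maximalIdeal S) S]
    {J : ℕ → Ideal S} (hJ : Antitone J) (hpow : ∀ e, ∃ k, maximalIdeal S ^ k ≤ J e) {Q : Ideal S}
    {n : ℕ} (hQ : maximalIdeal S ^ n ≤ Q) (h : ∀ e, ¬ J e ≤ Q) : ∃ s ∉ Q, ∀ e, s ∈ J e := by
  set m := maximalIdeal S with hm
  -- modulo each power of `𝔪` the sequence is eventually constant
  have hstab : ∀ N, ∃ e₀, ∀ e, J e₀ ≤ J e ⊔ m ^ N := by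
    intro N
    have := (isFiniteLength_iff_isNoetherian_isArtinian.1
      (isFiniteLength_quotient_of_pow_le (le_refl (m ^ N)))).2
    obtain ⟨e₀, he₀⟩ := IsArtinian.monotone_stabilizes (R := S) (M := S ⧸ m ^ N)
      ⟨fun e => OrderDual.toDual (Submodule.map (m ^ N).mkQ (J e)), fun a b hab =>
        OrderDual.toDual_le_toDual.2 (Submodule.map_mono (hJ hab))⟩
    refine ⟨e₀, fun e => ?_⟩
    rcases le_total e₀ e with hle | hle
    · have h1 : Submodule.map (m ^ N).mkQ (J e₀) = Submodule.map (m ^ N).mkQ (J e) :=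
        congrArg OrderDual.ofDual (he₀ e hle)
      intro x hx
      have h2 : (m ^ N).mkQ x ∈ Submodule.map (m ^ N).mkQ (J e) := h1 ▸ Submodule.mem_map_of_mem hx
      obtain ⟨y, hy, hxy⟩ := h2
      rw [← sub_add_cancel x y, add_comm]
      exact Submodule.add_mem_sup hy ((Submodule.Quotient.eq _).1 hxy.symm)
    · exact (hJ hle).trans le_sup_left
  choose E hE using hstab
  -- a Cauchy sequence of elements of the ideals `J (E (n + i))`, starting outside `Q`
  have hlift : ∀ (i : ℕ) (s : J (E (n + i))), ∃ s' : J (E (n + (i + 1))),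
      (s' : S) - s ∈ m ^ (n + i) := by
    rintro i ⟨s, hs⟩
    obtain ⟨y, hy, t, ht, rfl⟩ := Submodule.mem_sup.1 (hE _ (E (n + (i + 1))) hs)
    exact ⟨⟨y, hy⟩, by simpa using ht⟩
  choose f hf using hlift
  obtain ⟨s₀, hs₀, hs₀Q⟩ := SetLike.not_le_iff_exists.1 (h (E (n + 0)))
  let s : ∀ i, J (E (n + i)) := fun i =>
    Nat.rec (motive := fun i => J (E (n + i))) ⟨s₀, hs₀⟩ (fun i x => f i x) i
  have hs : ∀ i, (s (i + 1) : S) - (s i : S) ∈ m ^ (n + i) := fun i => hf i (s i)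
  have hs' : ∀ i j, i ≤ j → (s j : S) - (s i : S) ∈ m ^ (n + i) := by
    intro i j hij
    induction j, hij using Nat.le_induction with
    | base => simp
    | succ j hij ih =>
      rw [← sub_add_sub_cancel _ (s j : S)]
      exact add_mem (Ideal.pow_le_pow_right (by omega) (hs j)) ih
  have hcauchy : ∀ {i j : ℕ}, i ≤ j → (s i : S) ≡ s j [SMOD m ^ i • (⊤ : Submodule S S)] := by
    intro i j hij
    rw [SModEq.comm, SModEq.sub_mem, smul_eq_mul, Ideal.mul_top]
    exact Ideal.pow_le_pow_right (by omega) (hs' i j hij)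
  obtain ⟨L, hL⟩ := IsPrecomplete.prec' (I := m) (M := S) _ hcauchy
  have hL' : ∀ i, L - s i ∈ m ^ i := fun i => by
    have := hL i
    rwa [SModEq.comm, SModEq.sub_mem, smul_eq_mul, Ideal.mul_top] at this
  refine ⟨L, fun hLQ => hs₀Q ?_, fun e => ?_⟩
  · have h1 := hQ (hL' n)
    have h2 : (s n : S) - s 0 ∈ Q := hQ (hs' 0 n (Nat.zero_le n))
    have h3 : (s 0 : S) = L - (L - s n) - (s n - s 0) := by ring
    change (s 0 : S) ∈ Q
    rw [h3]
    exact Q.sub_mem (Q.sub_mem hLQ h1) h2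
  · obtain ⟨k, hk⟩ := hpow e
    have h1 : (s k : S) ∈ J e :=
      (sup_le le_rfl ((Ideal.pow_le_pow_right (by omega)).trans hk)) (hE (n + k) e (s k).2)
    simpa using (J e).add_mem (hk (hL' k)) h1

/-- If `P` is a prime of a complete `F`-finite local ring, then `S ⧸ P` has irreducible ideals
primary to the maximal ideal inside all powers of the maximal ideal. -/
lemma exists_isSocleGenerator_of_isPrime [IsAdicComplete (maximalIdeal S) S] {p : ℕ}
    [Fact p.Prime] [ExpChar S p] (hF : FFinite S p) (P : Ideal S) [P.IsPrime] (n : ℕ) :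
    ∃ (I : Ideal S) (u : S), IsSocleGenerator I u ∧ P ≤ I ∧ I ≤ P ⊔ maximalIdeal S ^ n := by
  let f := Ideal.Quotient.mk P
  have hf : Function.Surjective f := Ideal.Quotient.mk_surjective
  have : IsLocalRing (S ⧸ P) := .of_surjective' f hf
  have hloc := IsLocalHom.of_surjective f hf
  have hmap : (maximalIdeal S).map f ≤ maximalIdeal (S ⧸ P) := ((local_hom_TFAE f).out 0 2).1 hloc
  have : ExpChar (S ⧸ P) p := expChar_of_ringHom f p
  have : ExpChar (ResidueField (S ⧸ P)) p := expChar_of_ringHom (residue (S ⧸ P)) p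
  have hFB : FFinite (S ⧸ P) p := hF.of_surjective f hf
  have hp : p.Prime := Fact.out
  obtain ⟨π, hπ, c, hc, hval, htest⟩ := exists_testElement hFB
  -- the socle generator `c * c` ensures that `J₀` contains neither `c` nor `c * c`
  obtain ⟨J₀, hJ₀⟩ := exists_isSocleGenerator_of_ne_zero (mul_ne_zero hc hc)
  let I : ℕ → Ideal (S ⧸ P) := fun e => (cartierPullback π)^[e] J₀
  have hI : ∀ e s, s ∈ I e ↔ ∀ r, π^[e] (r * s) ∈ J₀ := fun e s =>
    mem_iterate_cartierPullback hπ e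
  have hcJ₀ : c ∉ J₀ := fun h => hJ₀.notMem (J₀.mul_mem_left c h)
  have hgen : ∀ e, ∃ u, IsSocleGenerator (I e) u := by
    intro e
    induction e with
    | zero => exact ⟨_, hJ₀⟩
    | succ e ih =>
      obtain ⟨u, hu⟩ := ih
      have hne : I (e + 1) ≠ ⊤ := by
        intro htop
        obtain ⟨r, hr⟩ := hval (e + 1)
        have h1 : (1 : S ⧸ P) ∈ I (e + 1) := htop ▸ Submodule.mem_top
        have := (hI _ _).1 h1 r
        rw [mul_one, hr] at this
        exact hcJ₀ this
      simp only [I, Function.iterate_succ_apply'] at hne ⊢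
      exact hu.cartierPullback hFB hπ hne
  -- multiplication by `c` makes the sequence `I e` decreasing
  have hcI : ∀ i e, i ≤ e → ∀ s ∈ I e, c * s ∈ I i := by
    intro i e hie s hs
    obtain ⟨b, rfl⟩ := Nat.exists_eq_add_of_le hie
    obtain ⟨x, hx⟩ := hval b
    rw [hI]
    intro r
    have h1 : r * (c * s) = π^[b] ((r * s) ^ p ^ b * x) := by
      rw [hπ.iterate, hx]; ring
    obtain ⟨q, hq⟩ := Nat.exists_eq_succ_of_ne_zero (pow_pos hp.pos b).ne'
    rw [h1, ← Function.iterate_add_apply, hq, Nat.succ_eq_add_one, pow_succ]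
    have h2 : (r * s) ^ q * (r * s) * x = ((r * s) ^ q * r * x) * s := by ring
    rw [h2]
    exact (hI _ _).1 hs _
  have hQ : (maximalIdeal (S ⧸ P) ^ n).comap f ≤ P ⊔ maximalIdeal S ^ n := by
    have h1 : maximalIdeal (S ⧸ P) ≤ (maximalIdeal S).map f := by
      intro x hx
      obtain ⟨y, rfl⟩ := hf x
      refine Ideal.mem_map_of_mem f ?_
      have hcm : (maximalIdeal (S ⧸ P)).comap f = maximalIdeal S :=
        ((local_hom_TFAE f).out 0 4).1 hloc
      rw [← hcm]
      exact hx
    refine (Ideal.comap_mono ((Ideal.pow_right_mono h1 n).trans (Ideal.map_pow f _ n).ge)).trans ?_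
    rw [Ideal.comap_map_of_surjective' f hf, Ideal.mk_ker, sup_comm]
  by_cases hex : ∃ e, I e ≤ maximalIdeal (S ⧸ P) ^ n
  · obtain ⟨e, he⟩ := hex
    obtain ⟨u, hu⟩ := hgen e
    obtain ⟨v, hv⟩ := hu.comap hf
    refine ⟨(I e).comap f, v, hv, fun a ha => ?_, (Ideal.comap_mono he).trans hQ⟩
    rw [Ideal.mem_comap, Ideal.Quotient.eq_zero_iff_mem.2 ha]
    exact Submodule.zero_mem _
  push Not at hex
  exfalso
  -- otherwise Chevalley's theorem yields `s` with `f s ≠ 0` and `c * f s` in all `I e`, so that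
  -- `J₀` contains the test element `c`
  let J : ℕ → Ideal S := fun e =>
    { carrier := {s | ∀ i ≤ e, c * f s ∈ I i}
      zero_mem' := fun i _ => by simp
      add_mem' := fun ha hb i hi => by
        rw [map_add, mul_add]
        exact (I i).add_mem (ha i hi) (hb i hi)
      smul_mem' := fun a s hs i hi => by
        rw [smul_eq_mul, map_mul, mul_left_comm]
        exact (I i).mul_mem_left _ (hs i hi) }
  have hJanti : Antitone J := fun a b hab s hs i hi => hs i (hi.trans hab)
  have hJpow : ∀ e, ∃ k, maximalIdeal S ^ k ≤ J e := by
    intro e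
    choose u hu using hgen
    choose k hk using fun i => (hu i).exists_pow_le
    refine ⟨(Finset.range (e + 1)).sup k, fun s hs i hi => (I i).mul_mem_left c (hk i ?_)⟩
    have h1 := Ideal.mem_map_of_mem f hs
    rw [Ideal.map_pow] at h1
    exact Ideal.pow_le_pow_right (Finset.le_sup (Finset.mem_range.2 (by omega)))
      (Ideal.pow_right_mono hmap _ h1)
  obtain ⟨s, hsQ, hs⟩ := exists_notMem_forall_mem_of_antitone hJanti hJpow
    (Q := (maximalIdeal (S ⧸ P) ^ n).comap f) (n := n)
    (Ideal.map_le_iff_le_comap.1 (by rw [Ideal.map_pow]; exact Ideal.pow_right_mono hmap n))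
    (fun e hle => hex e fun x hx => by
      obtain ⟨y, rfl⟩ := hf x
      exact hle (fun i hi => hcI i e hi _ hx))
  have hfs : f s ≠ 0 := fun h0 => hsQ (by rw [Ideal.mem_comap, h0]; exact Submodule.zero_mem _)
  exact hcJ₀ (htest J₀ (c * f s) (mul_ne_zero hc hfs) fun b r => (hI b _).1 (hs b b le_rfl) r)

/-- A complete reduced `F`-finite local ring is approximately Gorenstein. -/
lemma exists_isSocleGenerator_le_pow_of_isAdicComplete [IsAdicComplete (maximalIdeal S) S]
    [IsReduced S] {p : ℕ} [Fact p.Prime] [ExpChar S p] (hF : FFinite S p) (n : ℕ) :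
    ∃ (I : Ideal S) (u : S), IsSocleGenerator I u ∧ I ≤ maximalIdeal S ^ n := by
  classical
  obtain ⟨M, hM⟩ := (minimalPrimes.finite_of_isNoetherianRing S).exists_finset_coe
  have hMp : ∀ P ∈ M, P.IsPrime := fun P hP => Ideal.IsMinimalPrime.isPrime
    (show P ∈ minimalPrimes S from hM ▸ hP)
  -- elements lying in all minimal primes but one
  have hc : ∀ P ∈ M, ∃ c, c ∉ P ∧ ∀ Q ∈ M, Q ≠ P → c ∈ Q := by
    intro P hP
    by_contra! hcon
    have hle : (M.erase P).inf id ≤ P := by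
      intro x hx
      by_contra hxP
      obtain ⟨Q, hQ, hne, hxQ⟩ := hcon x hxP
      exact hxQ (Finset.inf_le (f := id) (Finset.mem_erase.2 ⟨hne, hQ⟩) hx)
    obtain ⟨Q, hQ, hQP⟩ := (hMp P hP).inf_le'.1 hle
    rw [Finset.mem_erase] at hQ
    have hPmin : P ∈ minimalPrimes S := hM ▸ hP
    exact hQ.1 (le_antisymm hQP (hPmin.2 ⟨hMp Q hQ.2, bot_le⟩ hQP))
  choose! c hcP hcQ using hc
  have hzero : ∀ x, (∀ P ∈ M, x ∈ P) → x = 0 := by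
    intro x hx
    have : x ∈ sInf (minimalPrimes S) := by
      rw [Submodule.mem_sInf]
      intro P hP
      exact hx P (by rwa [← Finset.mem_coe, hM])
    rw [minimalPrimes, Ideal.sInf_minimalPrimes] at this
    exact (nilradical_eq_zero S ▸ this : x ∈ (0 : Ideal S))
  let J : ℕ → Ideal S := fun N =>
    ⨅ P ∈ M, Submodule.comap (LinearMap.mulRight S (c P)) (P ⊔ maximalIdeal S ^ N)
  have hJ : ∀ N s, s ∈ J N ↔ ∀ P ∈ M, s * c P ∈ P ⊔ maximalIdeal S ^ N := by
    intro N s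
    simp [J, Submodule.mem_iInf]
  -- Chevalley's theorem, as the elements in all `J N` lie in all minimal primes
  obtain ⟨N, hN⟩ : ∃ N, J N ≤ maximalIdeal S ^ (n + 1) := by
    by_contra! hcon
    obtain ⟨s, hsn, hs⟩ := exists_notMem_forall_mem_of_antitone (J := J)
      (fun a b hab s hs => (hJ _ _).2 fun P hP => (sup_le_sup_left (α := Ideal S)
        (Ideal.pow_le_pow_right hab) P) ((hJ _ _).1 hs P hP))
      (fun N => ⟨N, fun s hs => (hJ _ _).2 fun P _ =>
        Ideal.mem_sup_right (Ideal.mul_mem_right _ _ hs)⟩) le_rfl hcon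
    refine hsn ?_
    rw [hzero s fun P hP => ?_]
    · exact Submodule.zero_mem _
    refine ((hMp P hP).mem_or_mem ?_).resolve_right (hcP P hP)
    rw [← Ideal.Quotient.eq_zero_iff_mem]
    refine (inferInstance : IsHausdorff (maximalIdeal S) (S ⧸ P)).haus' _ fun N => ?_
    obtain ⟨a, ha, t, ht, hat⟩ := Submodule.mem_sup.1 ((hJ N s).1 (hs N) P hP)
    rw [SModEq.zero, ← hat, map_add, Ideal.Quotient.eq_zero_iff_mem.2 ha, zero_add]
    have : Ideal.Quotient.mk P t = t • (1 : S ⧸ P) := by rw [Algebra.smul_def, mul_one]; rfl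
    rw [this]
    exact Submodule.smul_mem_smul ht trivial
  obtain ⟨E, _, _, ι, hι⟩ := exists_isInjectiveHull S (ResidueField S)
  have hx : ∀ P ∈ M, ∃ x : E, P ≤ Ideal.torsionOf S E x ∧
      Ideal.torsionOf S E x ≤ P ⊔ maximalIdeal S ^ N := by
    intro P hP
    have := hMp P hP
    obtain ⟨I, u, hI, hPI, hIP⟩ := exists_isSocleGenerator_of_isPrime hF P N
    obtain ⟨x, hx, -⟩ := hI.exists_torsionOf_eq hι
    exact ⟨x, hx ▸ hPI, hx ▸ hIP⟩
  choose! x hPx hxP using hx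
  -- multiplication by `c P` isolates the summand `x P`, so the annihilator of the sum is in `J N`
  have hle : Ideal.torsionOf S E (∑ P ∈ M, x P) ≤ maximalIdeal S ^ (n + 1) := by
    intro r hr
    refine hN ((hJ N r).2 fun P hP => hxP P hP ?_)
    rw [Ideal.mem_torsionOf_iff] at hr ⊢
    have h1 : c P • ∑ Q ∈ M, x Q = c P • x P := by
      rw [Finset.smul_sum]
      refine Finset.sum_eq_single_of_mem P hP fun Q hQ hne => ?_
      exact (Ideal.mem_torsionOf_iff _ _).1 (hPx Q hQ (hcQ P hP Q hQ hne))
    rw [mul_smul, ← h1, smul_comm, hr, smul_zero]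
  have hne : ∑ P ∈ M, x P ≠ 0 := by
    intro h0
    have h1 : (1 : S) ∈ maximalIdeal S ^ (n + 1) := hle (by
      rw [Ideal.mem_torsionOf_iff, h0, smul_zero])
    exact (Ideal.ne_top_iff_one _).1 (Ideal.IsPrime.ne_top inferInstance)
      (Ideal.pow_le_self (Nat.succ_ne_zero n) h1)
  obtain ⟨v, hv⟩ := hι.exists_smul_eq_map_one hne
  exact ⟨_, v, hι.isSocleGenerator_torsionOf hv, hle.trans (Ideal.pow_le_pow_right n.le_succ)⟩

end Complete

/-! ### Passage to the completion -/

/-- `φ : R → S` exhibits the local ring `S` as the completion of the local ring `R`. -/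
structure IsCompletionHom {R S : Type*} [CommRing R] [IsLocalRing R] [CommRing S] [IsLocalRing S]
    (φ : R →+* S) : Prop where
  complete : IsAdicComplete (maximalIdeal S) S
  map_eq : (maximalIdeal R).map φ = maximalIdeal S
  dense : ∀ n s, ∃ r, s - φ r ∈ maximalIdeal S ^ n
  comap_le : ∀ n, (maximalIdeal S ^ n).comap φ ≤ maximalIdeal R ^ n

lemma isCompletionHom_adicCompletion (R : Type u) [CommRing R] [IsLocalRing R]
    [IsNoetherianRing R] :
    IsCompletionHom (algebraMap R (AdicCompletion (maximalIdeal R) R)) := by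
  have hmem : ∀ (n : ℕ) (x : AdicCompletion (maximalIdeal R) R),
      x ∈ maximalIdeal (AdicCompletion (maximalIdeal R) R) ^ n ↔
        AdicCompletion.eval (maximalIdeal R) R n x = 0 := by
    intro n x
    rw [← LinearMap.mem_ker,
      ← AdicCompletion.pow_smul_top_eq_ker_eval (maximalIdeal R).fg_of_isNoetherianRing,
      AdicCompletion.maximalIdeal_eq_map, ← Ideal.map_pow, Ideal.smul_top_eq_map]
    rfl
  refine ⟨inferInstance, AdicCompletion.maximalIdeal_eq_map.symm, fun n s => ?_, fun n r hr => ?_⟩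
  · obtain ⟨r, hr⟩ := Submodule.Quotient.mk_surjective _
      (AdicCompletion.eval (maximalIdeal R) R n s)
    refine ⟨r, (hmem n _).2 ?_⟩
    rw [map_sub, ← hr, sub_eq_zero]
    rfl
  · have h := (hmem n _).1 hr
    have h2 : (Submodule.Quotient.mk r : R ⧸ (maximalIdeal R ^ n • ⊤ : Submodule R R)) = 0 := h
    rw [Submodule.Quotient.mk_eq_zero, smul_eq_mul, Ideal.mul_top] at h2
    exact h2

/-- Successive approximation in a complete local ring: if every element of `G k` can be moved
into `G (k + 1)` by subtracting a combination of the `l j` with coefficients in `𝔪 ^ k`, then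
the `l j` generate `G 0`. -/
lemma exists_eq_sum_smul_of_approx {S M : Type*} [CommRing S] [IsLocalRing S]
    [IsAdicComplete (maximalIdeal S) S] [AddCommGroup M] [Module S M] {n : ℕ} (l : Fin n → M)
    (G : ℕ → Submodule S M) (hG : ∀ x, (∀ k, x ∈ G k) → x = 0)
    (hl : ∀ k j, ∀ a ∈ maximalIdeal S ^ k, a • l j ∈ G k)
    (happrox : ∀ k, ∀ x ∈ G k, ∃ a : Fin n → S, (∀ j, a j ∈ maximalIdeal S ^ k) ∧
      x - ∑ j, a j • l j ∈ G (k + 1)) {x : M} (hx : x ∈ G 0) :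
    ∃ a : Fin n → S, x = ∑ j, a j • l j := by
  have hstep : ∀ k (y : G k), ∃ a : Fin n → S, (∀ j, a j ∈ maximalIdeal S ^ k) ∧
      (y : M) - ∑ j, a j • l j ∈ G (k + 1) := fun k y => happrox k y y.2
  choose a ha hay using hstep
  let y : ∀ k, G k := fun k => Nat.rec (motive := fun k => G k) ⟨x, hx⟩
    (fun k y => ⟨_, hay k y⟩) k
  have hy : ∀ k, (y (k + 1) : M) = (y k : M) - ∑ j, a k (y k) j • l j := fun k => rfl
  let A : ℕ → Fin n → S := fun k j => ∑ i ∈ Finset.range k, a i (y i) j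
  have hAy : ∀ k, x = (y k : M) + ∑ j, A k j • l j := by
    intro k
    induction k with
    | zero => simp [A, y]
    | succ k ih =>
      rw [hy, ih]
      simp only [A, Finset.sum_range_succ, add_smul, Finset.sum_add_distrib]
      abel
  have hcauchy : ∀ j, ∀ {i k : ℕ}, i ≤ k →
      A i j ≡ A k j [SMOD maximalIdeal S ^ i • (⊤ : Submodule S S)] := by
    intro j i k hik
    rw [SModEq.comm, SModEq.sub_mem, smul_eq_mul, Ideal.mul_top]
    induction k, hik using Nat.le_induction with
    | base => simp
    | succ k hik ih =>
      have : A (k + 1) j - A i j = (A k j - A i j) + a k (y k) j := by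
        simp only [A, Finset.sum_range_succ]
        ring
      rw [this]
      exact add_mem ih (Ideal.pow_le_pow_right hik (ha k (y k) j))
  choose B hB using fun j => IsPrecomplete.prec' (I := maximalIdeal S) (M := S) _ (hcauchy j)
  refine ⟨B, sub_eq_zero.1 (hG _ fun k => ?_)⟩
  have h1 : x - ∑ j, B j • l j = (y k : M) + ∑ j, (A k j - B j) • l j := by
    simp only [sub_smul, Finset.sum_sub_distrib]
    nth_rw 1 [hAy k]
    abel
  rw [h1]
  refine add_mem (y k).2 (sum_mem fun j _ => hl k j _ ?_)
  have := hB j k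
  rwa [SModEq.sub_mem, smul_eq_mul, Ideal.mul_top] at this

section Noetherian

variable {R S : Type u} [CommRing R] [IsLocalRing R] [CommRing S] [IsLocalRing S]
  {φ : R →+* S}

lemma IsCompletionHom.map_mem_pow (hφ : IsCompletionHom φ) {n : ℕ} {r : R}
    (hr : r ∈ maximalIdeal R ^ n) : φ r ∈ maximalIdeal S ^ n := by
  rw [← hφ.map_eq, ← Ideal.map_pow]
  exact Ideal.mem_map_of_mem φ hr

lemma IsCompletionHom.eq_zero_of_forall_mem_pow (hφ : IsCompletionHom φ) {x : S}
    (hx : ∀ n, x ∈ maximalIdeal S ^ n) : x = 0 := by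
  have := hφ.complete
  refine (inferInstance : IsHausdorff (maximalIdeal S) S).haus' x fun n => ?_
  rw [SModEq.zero, smul_eq_mul, Ideal.mul_top]
  exact hx n

/-- The completion of a Noetherian local ring is Noetherian. For an ideal `L` of the completion,
the initial ideals of `L ∩ 𝔪 ^ n` form a filtration of `R`, which is stable by the Artin-Rees
lemma; lifts of generators of one of its members generate `L ∩ 𝔪 ^ n`. -/
lemma IsCompletionHom.isNoetherianRing [IsNoetherianRing R] (hφ : IsCompletionHom φ) :
    IsNoetherianRing S := by
  have := hφ.complete
  set m := maximalIdeal S with hm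
  rw [isNoetherianRing_iff_ideal_fg]
  intro L
  let F : (maximalIdeal R).Filtration R :=
    { N := fun n => ((L ⊓ m ^ n) ⊔ m ^ (n + 1)).comap φ
      mono := fun n => Ideal.comap_mono (sup_le_sup
        (inf_le_inf_left _ (Ideal.pow_le_pow_right n.le_succ)) (Ideal.pow_le_pow_right (by omega)))
      smul_le := fun n => by
        rw [smul_eq_mul, Ideal.mul_le]
        intro a ha r hr
        obtain ⟨x, hx, y, hy, hxy⟩ := Submodule.mem_sup.1 (Ideal.mem_comap.1 hr)
        have ha' : φ a ∈ m := by
            have h := hφ.map_mem_pow (n := 1) (r := a) (by rwa [pow_one])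
            rwa [pow_one] at h
        rw [Ideal.mem_comap, map_mul, ← hxy, mul_add]
        refine Submodule.add_mem_sup ⟨L.mul_mem_left _ hx.1, ?_⟩ ?_
        · rw [pow_succ']
          exact Ideal.mul_mem_mul ha' hx.2
        · rw [pow_succ']
          exact Ideal.mul_mem_mul ha' hy }
  have hF : F.Stable := by
    refine Ideal.Filtration.Stable.of_le ((maximalIdeal R).stableFiltration_stable ⊤) fun n => ?_
    change F.N n ≤ maximalIdeal R ^ n • ⊤
    rw [smul_eq_mul, Ideal.mul_top]
    exact (Ideal.comap_mono (sup_le inf_le_right (Ideal.pow_le_pow_right n.le_succ))).trans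
      (hφ.comap_le n)
  obtain ⟨n₀, hn₀⟩ := hF.exists_pow_smul_eq
  obtain ⟨d, g, hg⟩ := Submodule.fg_iff_exists_fin_generating_family.1
    (IsNoetherian.noetherian (F.N n₀))
  have hlift : ∀ j, ∃ l ∈ L ⊓ m ^ n₀, φ (g j) - l ∈ m ^ (n₀ + 1) := by
    intro j
    have h1 : g j ∈ F.N n₀ := hg ▸ Submodule.subset_span ⟨j, rfl⟩
    obtain ⟨x, hx, y, hy, hxy⟩ := Submodule.mem_sup.1 (Ideal.mem_comap.1 h1)
    exact ⟨x, hx, by rw [← hxy, add_sub_cancel_left]; exact hy⟩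
  choose l hl hlg using hlift
  have hspan : L ⊓ m ^ n₀ ≤ Ideal.span (Set.range l) := by
    intro x hx
    obtain ⟨a, rfl⟩ := exists_eq_sum_smul_of_approx l (fun k => L ⊓ m ^ (n₀ + k))
      (fun x hx => hφ.eq_zero_of_forall_mem_pow fun k =>
        Ideal.pow_le_pow_right (Nat.le_add_left k n₀) (hx k).2)
      (fun k j a ha => ⟨L.mul_mem_left _ (hl j).1, by
        rw [add_comm, pow_add, smul_eq_mul]
        exact Ideal.mul_mem_mul ha (hl j).2⟩)
      (fun k x hx => by
        obtain ⟨r, hr⟩ := hφ.dense (n₀ + k + 1) x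
        have hrF : r ∈ F.N (n₀ + k) := by
          change φ r ∈ (L ⊓ m ^ (n₀ + k)) ⊔ m ^ (n₀ + k + 1)
          rw [← sub_sub_cancel x (φ r), sub_eq_add_neg]
          exact Submodule.add_mem_sup hx (neg_mem hr)
        rw [hn₀, ← hg, Submodule.mem_ideal_smul_span_iff_exists_sum] at hrF
        obtain ⟨a, ha, rfl⟩ := hrF
        rw [Finsupp.sum_fintype _ _ (by simp)] at hr
        have hsum : ∑ j, φ (a j) • l j ∈ L := sum_mem fun j _ => L.mul_mem_left _ (hl j).1
        refine ⟨fun j => φ (a j), fun j => hφ.map_mem_pow (ha j), sub_mem hx.1 hsum, ?_⟩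
        have h1 : x - ∑ j, φ (a j) • l j =
            (x - φ (∑ j, a j • g j)) + ∑ j, φ (a j) * (φ (g j) - l j) := by
          simp only [map_sum, smul_eq_mul, map_mul, mul_sub, Finset.sum_sub_distrib]
          ring
        rw [h1]
        refine add_mem hr (sum_mem fun j _ => ?_)
        have : n₀ + (k + 1) = k + (n₀ + 1) := by omega
        rw [this, pow_add]
        exact Ideal.mul_mem_mul (hφ.map_mem_pow (ha j)) (hlg j))
      (x := x) (by simpa using hx)
    exact sum_mem fun j _ => Ideal.mul_mem_left _ _ (Ideal.subset_span ⟨j, rfl⟩)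
  refine Submodule.fg_of_fg_map_of_fg_inf_ker (m ^ n₀).mkQ ?_ ?_
  · have hsurj : Function.Surjective ((Ideal.Quotient.mk (m ^ n₀)).comp φ) := by
      intro y
      obtain ⟨s, rfl⟩ := Ideal.Quotient.mk_surjective y
      obtain ⟨r, hr⟩ := hφ.dense n₀ s
      exact ⟨r, (Ideal.Quotient.eq.2 hr).symm⟩
    have h1 : IsNoetherianRing (S ⧸ m ^ n₀) := isNoetherianRing_of_surjective R _ _ hsurj
    have h2 : IsNoetherian S (S ⧸ m ^ n₀) := by
      have e : Submodule (S ⧸ m ^ n₀) (S ⧸ m ^ n₀) ≃o Submodule S (S ⧸ m ^ n₀) :=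
        Submodule.orderIsoOfAlgebraMapSurjective Ideal.Quotient.mk_surjective
      have := isNoetherian_iff'.1 h1
      exact isNoetherian_iff'.2 e.symm.strictMono.wellFoundedGT
    exact IsNoetherian.noetherian _
  · rw [Submodule.ker_mkQ]
    have : L ⊓ m ^ n₀ = Ideal.span (Set.range l) :=
      le_antisymm hspan (Ideal.span_le.2 (by rintro _ ⟨j, rfl⟩; exact hl j))
    rw [this]
    exact Submodule.fg_span (Set.finite_range l)

end Noetherian

section Frobenius

/-- Deep powers of the maximal ideal lie in the Frobenius powers of its powers. -/
lemma exists_toTwist_mem_pow_smul_top {R : Type u} [CommRing R] [IsLocalRing R]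
    [IsNoetherianRing R] (p : ℕ) [ExpChar R p] (n : ℕ) : ∃ K, ∀ r ∈ maximalIdeal R ^ K,
      toTwist R p 1 r ∈ (maximalIdeal R ^ n • ⊤ : Submodule R (FrobeniusTwist R p 1)) := by
  have hmem : ∀ r, toTwist R p 1 r ∈ (maximalIdeal R ^ n • ⊤ : Submodule R (FrobeniusTwist R p 1)) ↔
      r ∈ ((maximalIdeal R ^ n).map (algebraMap R (FrobeniusTwist R p 1))).comap
        (toTwist R p 1 : R →+* FrobeniusTwist R p 1) := by
    intro r
    rw [Ideal.smul_top_eq_map]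
    rfl
  simp_rw [hmem]
  refine Ideal.exists_pow_le_of_le_radical_of_fg (fun a ha => ⟨n * p, ?_⟩)
    (IsNoetherian.noetherian _)
  rw [← hmem, pow_mul]
  have : toTwist R p 1 ((a ^ n) ^ p) = a ^ n • toTwist R p 1 1 := by
    rw [smul_toTwist, pow_one, mul_one]
  rw [this]
  exact Submodule.smul_mem_smul (Ideal.pow_mem_pow ha n) trivial

/-- In a reduced `F`-finite local ring, `r ^ p` can only be close to `0` if `r` is, by the
Artin-Rees lemma for the inclusion of `R` in `R^{(1)}`. -/
lemma exists_forall_mem_pow_of_pow_mem {R : Type u} [CommRing R] [IsLocalRing R]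
    [IsNoetherianRing R] [IsReduced R] {p : ℕ} [ExpChar R p] (hF : FFinite R p) (n : ℕ) :
    ∃ N, ∀ r, r ^ p ∈ maximalIdeal R ^ N → r ∈ maximalIdeal R ^ n := by
  have := (ffinite_iff_finite_frobeniusTwist p).1 hF
  let f : R →ₗ[R] FrobeniusTwist R p 1 := LinearMap.toSpanSingleton R _ (toTwist R p 1 1)
  have hf : ∀ r, f r = toTwist R p 1 (r ^ p) := fun r => by
    rw [LinearMap.toSpanSingleton_apply, smul_toTwist, pow_one, mul_one]
  have hinj : Function.Injective f := by
    intro r s hrs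
    rw [hf, hf, (toTwist R p 1).injective.eq_iff] at hrs
    exact frobenius_inj R p hrs
  obtain ⟨k, hk⟩ := (maximalIdeal R).exists_pow_inf_eq_pow_smul (LinearMap.range f)
  obtain ⟨N, hN⟩ := exists_toTwist_mem_pow_smul_top (R := R) p (n + k)
  refine ⟨N, fun r hr => ?_⟩
  have h1 : f r ∈ maximalIdeal R ^ (n + k) • ⊤ ⊓ LinearMap.range f :=
    ⟨by rw [hf]; exact hN _ hr, ⟨r, rfl⟩⟩
  rw [hk _ (Nat.le_add_left k n), Nat.add_sub_cancel] at h1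
  have h2 : f r ∈ (maximalIdeal R ^ n • ⊤ : Submodule R R).map f := by
    rw [Submodule.map_smul'', Submodule.map_top]
    exact Submodule.smul_mono le_rfl inf_le_right h1
  obtain ⟨s, hs, hsr⟩ := h2
  rw [← hinj hsr]
  simpa using hs

variable {R S : Type u} [CommRing R] [IsLocalRing R] [IsNoetherianRing R] [CommRing S]
  [IsLocalRing S] {φ : R →+* S} {p : ℕ} [ExpChar R p]

/-- The completion of a reduced `F`-finite local ring is reduced. -/
lemma IsCompletionHom.isReduced [IsReduced R] (hφ : IsCompletionHom φ) (hF : FFinite R p)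
    [hp : Fact p.Prime] : IsReduced S := by
  rw [isReduced_iff_pow_one_lt p hp.out.one_lt]
  intro x hx
  refine hφ.eq_zero_of_forall_mem_pow fun n => ?_
  obtain ⟨N, hN⟩ := exists_forall_mem_pow_of_pow_mem hF n
  obtain ⟨r, hr⟩ := hφ.dense (max n N) x
  have h1 : φ (r ^ p) ∈ maximalIdeal S ^ N := by
    have h2 : x ^ p - φ r ^ p ∈ maximalIdeal S ^ N :=
      Ideal.mem_of_dvd _ (sub_dvd_pow_sub_pow _ _ p)
        (Ideal.pow_le_pow_right (le_max_right _ _) hr)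
    rw [hx, zero_sub] at h2
    rw [map_pow]
    simpa using neg_mem h2
  have h2 := hφ.map_mem_pow (hN r (hφ.comap_le N h1))
  simpa using add_mem (Ideal.pow_le_pow_right (le_max_left n N) hr) h2

/-- The completion of an `F`-finite local ring is `F`-finite, by Nakayama's lemma for modules over
complete rings. -/
lemma IsCompletionHom.ffinite [ExpChar S p] (hφ : IsCompletionHom φ) (hF : FFinite R p) :
    FFinite S p := by
  have := hφ.complete
  have := hφ.isNoetherianRing
  obtain ⟨n, f, hf⟩ := (ffinite_iff p).1 hF
  let T := toTwist S p 1
  let l : Fin n → FrobeniusTwist S p 1 := fun j => T (φ (f j))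
  -- the images of generators of `R^{(1)}` generate `S^{(1)}` modulo `𝔪 S^{(1)}`
  have htop : (⊤ : Submodule S (FrobeniusTwist S p 1)) ≤
      Submodule.span S (Set.range l) ⊔ maximalIdeal S • ⊤ := by
    intro x _
    obtain ⟨x, rfl⟩ := T.surjective x
    obtain ⟨K, hK⟩ := exists_toTwist_mem_pow_smul_top (R := S) p 1
    obtain ⟨r, hr⟩ := hφ.dense K x
    obtain ⟨a, rfl⟩ := hf r
    have h1 : T (φ (∑ j, a j ^ p * f j)) = ∑ j, φ (a j) • l j := by
      rw [map_sum φ, map_sum T]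
      refine Finset.sum_congr rfl fun j _ => ?_
      rw [smul_toTwist, map_mul, map_pow, pow_one]
    have h2 := hK _ hr
    rw [pow_one] at h2
    rw [← add_sub_cancel (φ (∑ j, a j ^ p * f j)) x, map_add, h1]
    refine Submodule.add_mem_sup (sum_mem fun j _ => ?_) h2
    exact Submodule.smul_mem _ _ (Submodule.subset_span ⟨j, rfl⟩)
  have hpow : ∀ k, ∀ x ∈ (maximalIdeal S ^ k • ⊤ : Submodule S (FrobeniusTwist S p 1)),
      T.symm x ∈ maximalIdeal S ^ k := by
    intro k x hx
    refine Submodule.smul_induction_on hx (fun a ha y _ => ?_) fun x y hx hy => ?_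
    · obtain ⟨y, rfl⟩ := T.surjective y
      rw [smul_toTwist, T.symm_apply_apply, pow_one]
      exact Ideal.mul_mem_right _ _ (Ideal.pow_mem_of_mem _ ha p (expChar_pos S p))
    · rw [map_add]
      exact add_mem hx hy
  refine (ffinite_iff p).2 ⟨n, fun j => φ (f j), fun x => ?_⟩
  obtain ⟨a, ha⟩ := exists_eq_sum_smul_of_approx l (fun k => maximalIdeal S ^ k • ⊤)
    (fun x hx => T.symm.injective ((hφ.eq_zero_of_forall_mem_pow fun k => hpow k x (hx k)).trans
      (map_zero _).symm))
    (fun k j a ha => Submodule.smul_mem_smul ha trivial)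
    (fun k x hx => by
      have h1 := Submodule.smul_mono (le_refl (maximalIdeal S ^ k)) htop hx
      rw [Submodule.smul_sup, ← mul_smul, ← pow_succ] at h1
      obtain ⟨y, hy, z, hz, rfl⟩ := Submodule.mem_sup.1 h1
      rw [Submodule.mem_ideal_smul_span_iff_exists_sum] at hy
      obtain ⟨a, ha, rfl⟩ := hy
      refine ⟨a, ha, ?_⟩
      rwa [Finsupp.sum_fintype _ _ (by simp), add_sub_cancel_left])
    (x := T x) (by rw [pow_zero, Ideal.one_eq_top, Submodule.top_smul]; trivial)
  refine ⟨a, T.injective (ha.trans ?_)⟩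
  rw [map_sum]
  exact Finset.sum_congr rfl fun j _ => by rw [smul_toTwist, pow_one]

end Frobenius

/-- Irreducible ideals primary to the maximal ideal descend from the completion. -/
lemma IsSocleGenerator.comap_of_isCompletionHom {R S : Type*} [CommRing R] [IsLocalRing R]
    [CommRing S] [IsLocalRing S] {φ : R →+* S} (hφ : IsCompletionHom φ) {I : Ideal S} {u : S}
    (h : IsSocleGenerator I u) : ∃ v, IsSocleGenerator (I.comap φ) v := by
  obtain ⟨k, hk⟩ := h.exists_pow_le
  obtain ⟨v, hv⟩ := hφ.dense k u
  refine ⟨v, ⟨k, ?_⟩, fun hvI => h.notMem ?_, fun s hs => ?_⟩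
  · rw [← Ideal.map_le_iff_le_comap, Ideal.map_pow, hφ.map_eq]
    exact hk
  · simpa using I.add_mem (hk hv) hvI
  · obtain ⟨r, hr⟩ := h.exists_mul_sub_mem _ hs
    obtain ⟨r', hr'⟩ := hφ.dense k r
    refine ⟨r', ?_⟩
    have h1 : φ (r' * s - v) = (r * φ s - u) - (r - φ r') * φ s + (u - φ v) := by
      rw [map_sub, map_mul]; ring
    rw [Ideal.mem_comap, h1]
    exact I.add_mem (I.sub_mem hr (I.mul_mem_right _ (hk hr'))) (hk hv)

/-! ### Approximate Gorensteinness and the equivalence -/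

/-- A reduced `F`-finite Noetherian local ring is approximately Gorenstein. -/
theorem exists_isSocleGenerator_le_pow {R : Type u} [CommRing R] [IsLocalRing R]
    [IsNoetherianRing R] [IsReduced R] {p : ℕ} [Fact p.Prime] [ExpChar R p] (hF : FFinite R p)
    (n : ℕ) : ∃ (I : Ideal R) (u : R), IsSocleGenerator I u ∧ I ≤ maximalIdeal R ^ n := by
  let S := AdicCompletion (maximalIdeal R) R
  have hφ := isCompletionHom_adicCompletion R
  have : ExpChar S p := expChar_of_ringHom (algebraMap R S) p
  have : IsNoetherianRing S := hφ.isNoetherianRing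
  have : IsReduced S := hφ.isReduced hF
  have : IsAdicComplete (maximalIdeal S) S := hφ.complete
  obtain ⟨I, u, hI, hIn⟩ :=
    exists_isSocleGenerator_le_pow_of_isAdicComplete (hφ.ffinite hF : FFinite S p) n
  obtain ⟨v, hv⟩ := hI.comap_of_isCompletionHom hφ
  exact ⟨_, v, hv, (Ideal.comap_mono hIn).trans (hφ.comap_le n)⟩

end FSignature

theorem mainTheorem4 (p : ℕ) [Fact p.Prime]
    (R : Type u) [CommRing R] [IsLocalRing R] [IsNoetherianRing R] [IsReduced R] [CharP R p]
    (hF : FSignature.FFinite R p)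
    (E : Type u) [AddCommGroup E] [Module R E] (ι : ResidueField R →ₗ[R] E)
    (hι : FSignature.IsInjectiveHull ι) :
    FSignature.ConditionA R p ↔ FSignature.ConditionB p ι :=
  ⟨fun h => h.conditionB p hι,
    fun h => h.conditionA p hι (FSignature.exists_isSocleGenerator_le_pow hF)⟩
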